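/- Let $K$ be a field containing an element $\omega$ of multiplicative order $3$, and let $$\mathrm{H}_{27}=\langle a,b,c\mid a^3=b^3=c^3=1,\ a^{-1}b^{-1}ab=c,\ ac=ca,\ bc=cb\rangle$$ be the Heisenberg group of order $27$. For a finite group $G$ and a finite-dimensional $KG$-module $V$ of dimension $n$, let $K[V]^G\subseteq K[V]=K[x_1,\dots,x_n]$ be the algebra of $G$-invariant polynomials, let $\beta_{\mathrm{sep}}(G,V)$ be the minimal positive integer $d$ such that any two points of $V$ with different $G$-orbits are distinguished by some element of $K[V]^G$ of degree at most $d$, and let $\beta_{\mathrm{sep}}^K(G)$ be the supremum of $\beta_{\mathrm{sep}}(G,V)$ over all finite-dimensional $KG$-modules $V$. Let $V_0=K^3$ be the representation of $\mathrm{H}_{27}$ given by $$a\mapsto\begin{bmatrix}1&0&0\\0&\omega&0\\0&0&\omega^2\end{bmatrix},\quad b\mapsto\begin{bmatrix}0&0&1\\1&0&0\\0&1&0\end{bmatrix},\quad c\mapsto\begin{bmatrix}\omega&0&0\\0&\omega&0\\0&0&\omega\end{bmatrix}.$$ 1. If $|K|\neq 4$ (in particular if $K$ is infinite), then $\beta_{\mathrm{sep}}^K(\mathrm{H}_{27})=9$;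 moreover, there are two points of $V_0$ with different $\mathrm{H}_{27}$-orbits on which all elements of $K[V_0]^{\mathrm{H}_{27}}$ of degree less than $9$ agree. 2. If $|K|=4$, then $\beta_{\mathrm{sep}}(\mathrm{H}_{27},V_0)=6$. -/

import Mathlib

namespace SepInv

open MvPolynomial

/-! ### Polynomial invariants and the separating Noether number

A finite-dimensional `KG`-module is given, in coordinates, by a homomorphism `ψ : G →* GL (Fin n) K`
acting on the column vectors `Fin n → K`; its coordinate ring is `MvPolynomial (Fin n) K`. -/

section General

variable {K : Type*} [Field K] {G : Type*} [Group G] {n : ℕ}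

/-- The orbit `G · v` of a column vector `v`, where `g · v = ψ(g) v`. -/
def orbit (ψ : G →* GL (Fin n) K) (v : Fin n → K) : Set (Fin n → K) :=
  Set.range fun g : G => (ψ g : Matrix (Fin n) (Fin n) K).mulVec v

/-- The action of `g` on the coordinate ring: the algebra homomorphism with
`g · x_j = ∑ i, ψ(g⁻¹)_{j i} x_i`, that is, `(g · f)(v) = f (g⁻¹ · v)`. -/
noncomputable def polyAct (ψ : G →* GL (Fin n) K) (g : G) :
    MvPolynomial (Fin n) K →ₐ[K] MvPolynomial (Fin n) K :=
  aeval fun j => ∑ i, C ((ψ g⁻¹ : Matrix (Fin n) (Fin n) K) j i) * X i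

/-- The algebra `K[V]^G` of polynomial invariants (invariant as polynomials, not only as
functions). -/
noncomputable def invariants (ψ : G →* GL (Fin n) K) : Subalgebra K (MvPolynomial (Fin n) K) :=
  ⨅ g : G, AlgHom.equalizer (polyAct ψ g) (AlgHom.id K (MvPolynomial (Fin n) K))

/-- A set of polynomials separates the orbits if any two points with different orbits are
distinguished by the value of a member of the set. -/
def IsSeparating (ψ : G →* GL (Fin n) K) (S : Set (MvPolynomial (Fin n) K)) : Prop :=
  ∀ v w : Fin n → K, orbit ψ v ≠ orbit ψ w → ∃ f ∈ S, eval v f ≠ eval w f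

/-- `β_sep(G, V)`: the minimal positive integer `d` such that the invariants of degree at most `d`
form a separating set (`⊤` if there were no such `d`). -/
noncomputable def betaSepRep (ψ : G →* GL (Fin n) K) : ℕ∞ :=
  sInf {e : ℕ∞ | ∃ d : ℕ, 0 < d ∧ e = (d : ℕ∞) ∧
    IsSeparating ψ {f | f ∈ invariants ψ ∧ f.totalDegree ≤ d}}

end General

/-- `β_sep^K(G)`: the supremum of `β_sep(G, V)` over all finite-dimensional `KG`-modules `V`. -/
noncomputable def betaSep (K : Type*) [Field K] (G : Type*) [Group G] : ℕ∞ :=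
  ⨆ (n : ℕ) (ψ : G →* GL (Fin n) K), betaSepRep ψ

/-! ### The Heisenberg group of order 27 and its three-dimensional representation -/

section Heisenberg

/-- The relators of `⟨a, b, c ∣ a³ = b³ = c³ = 1, a⁻¹ b⁻¹ a b = c, a c = c a, b c = c b⟩`,
where `a, b, c` are the free generators with index `0, 1, 2`. -/
def heisenbergRels : Set (FreeGroup (Fin 3)) :=
  let a := FreeGroup.of (0 : Fin 3)
  let b := FreeGroup.of (1 : Fin 3)
  let c := FreeGroup.of (2 : Fin 3)
  {a ^ 3, b ^ 3, c ^ 3, a⁻¹ * b⁻¹ * a * b * c⁻¹, a * c * (c * a)⁻¹, b * c * (c * b)⁻¹}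

/-- The Heisenberg group `H₂₇`. -/
abbrev H27 : Type := PresentedGroup heisenbergRels

variable {K : Type*} [Field K]

/-- The matrix of `a`. -/
def matA (ω : K) : Matrix (Fin 3) (Fin 3) K := !![1, 0, 0; 0, ω, 0; 0, 0, ω ^ 2]

/-- The matrix of `b`. -/
def matB (K : Type*) [Field K] : Matrix (Fin 3) (Fin 3) K := !![0, 0, 1; 1, 0, 0; 0, 1, 0]

/-- The matrix of `c`. -/
def matC (ω : K) : Matrix (Fin 3) (Fin 3) K := !![ω, 0, 0; 0, ω, 0; 0, 0, ω]

theorem matA_pow (ω : K) (h : ω ^ 3 = 1) : matA ω ^ 3 = 1 := by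
  have h6 : ω ^ 6 = 1 := by rw [show 6 = 3 * 2 from rfl, pow_mul, h, one_pow]
  ext i j
  fin_cases i <;> fin_cases j <;>
    simp [matA, pow_succ, Matrix.mul_apply, Fin.sum_univ_three] <;> ring_nf <;> assumption

theorem matB_pow : matB K ^ 3 = 1 := by
  ext i j
  fin_cases i <;> fin_cases j <;> simp [matB, pow_succ, Matrix.mul_apply, Fin.sum_univ_three]

theorem matC_pow (ω : K) (h : ω ^ 3 = 1) : matC ω ^ 3 = 1 := by
  ext i j
  fin_cases i <;> fin_cases j <;>
    simp [matC, pow_succ, Matrix.mul_apply, Fin.sum_univ_three] <;> ring_nf <;> assumption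

/-- The images of the three generators, as invertible matrices. -/
def genImage (ω : K) (h : ω ^ 3 = 1) : Fin 3 → GL (Fin 3) K :=
  ![Units.ofPowEqOne (matA ω) 3 (matA_pow ω h) three_ne_zero,
    Units.ofPowEqOne (matB K) 3 matB_pow three_ne_zero,
    Units.ofPowEqOne (matC ω) 3 (matC_pow ω h) three_ne_zero]

theorem genImage_rels (ω : K) (h : ω ^ 3 = 1) :
    ∀ r ∈ heisenbergRels, FreeGroup.lift (genImage ω h) r = 1 := by
  have hab : matA ω * matB K = matB K * matA ω * matC ω := by
    ext i j
    fin_cases i <;> fin_cases j <;>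
      simp [matA, matB, matC, Matrix.mul_apply, Fin.sum_univ_three] <;> ring_nf
    exact h.symm
  have hac : matA ω * matC ω = matC ω * matA ω := by
    ext i j
    fin_cases i <;> fin_cases j <;>
      simp [matA, matC, Matrix.mul_apply, Fin.sum_univ_three]
    ring_nf
  have hbc : matB K * matC ω = matC ω * matB K := by
    ext i j
    fin_cases i <;> fin_cases j <;>
      simp [matB, matC, Matrix.mul_apply, Fin.sum_univ_three]
  have ha : genImage ω h 0 ^ 3 = 1 := Units.ext (matA_pow ω h)
  have hb : genImage ω h 1 ^ 3 = 1 := Units.ext matB_pow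
  have hc : genImage ω h 2 ^ 3 = 1 := Units.ext (matC_pow ω h)
  have hab' : genImage ω h 0 * genImage ω h 1 = genImage ω h 1 * genImage ω h 0 * genImage ω h 2 :=
    Units.ext hab
  have hac' : genImage ω h 0 * genImage ω h 2 = genImage ω h 2 * genImage ω h 0 := Units.ext hac
  have hbc' : genImage ω h 1 * genImage ω h 2 = genImage ω h 2 * genImage ω h 1 := Units.ext hbc
  intro r hr
  simp only [heisenbergRels, Set.mem_insert_iff, Set.mem_singleton_iff] at hr
  rcases hr with rfl | rfl | rfl | rfl | rfl | rfl
  · simpa using ha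
  · simpa using hb
  · simpa using hc
  · simp only [map_mul, map_inv, FreeGroup.lift_apply_of]
    rw [mul_assoc _ (genImage ω h 0), hab']
    group
  · simp only [map_mul, map_inv, FreeGroup.lift_apply_of]
    rw [hac', mul_inv_cancel]
  · simp only [map_mul, map_inv, FreeGroup.lift_apply_of]
    rw [hbc', mul_inv_cancel]

/-- The three-dimensional representation `ψ` of `H₂₇`, with `a ↦ diag(1, ω, ω²)`, `b ↦` the cyclic
permutation matrix and `c ↦ ω I`. -/
noncomputable def heisenbergRep (ω : K) (h : ω ^ 3 = 1) : H27 →* GL (Fin 3) K :=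
  PresentedGroup.toGroup (genImage_rels ω h)

end Heisenberg

end SepInv

namespace SepInv

open MvPolynomial

/-! ### Invariants, orbits and points on which low-degree invariants agree -/

section Basic

variable {K : Type*} [Field K] {G : Type*} [Group G] {n : ℕ}

/-! Upper bound 9. Since `K` contains a primitive cube root of unity, 3 is invertible, so the
polynomials of degree at most one split into joint eigenvectors of `c` and `a`. Where `c` acts by
`ω` or `ω²` they form copies of a three-dimensional representation with coordinates `x, y, z`
permuted cyclically by `b`; where `c` acts trivially the group acts through `C₃ × C₃`, by
characters.

Let `v, w` agree on invariants of degree at most 9. If some copy `x, y, z` does not vanish at one of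
the points, then `xyz`, the first two elementary symmetric polynomials in the cubes and the cyclic
sum of `x⁶y³` fix `(x, y, z)` up to the group (`sameOrbit_of_coords_ne_zero`), so `v` can be moved
until the coordinates agree. What is left is governed by the stabilizer of `(x, y, z)`. If it is
trivial, every other eigenvector `q` is recovered from an invariant consisting of `q` times a
multiplier in `x, y, z` that is nonzero at `v`, summed over powers of `b` if necessary
(`eq_of_one_zero`, `eq_of_generic`). If two coordinates vanish, the stabilizer has order 3 and one
more move suffices (`sameOrbit_of_two_zero`); if all cubes are equal and nonzero, a change of
generators leads back to that case (`sameOrbit_of_cubes_eq`). If all such copies vanish at both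
points, only characters of `C₃ × C₃` matter, and degree 5 is enough for them (`sameOrbit_of_agree`).

Lower bounds. On the plane `z = 0` of `V₀`, averaging over an orbit kills every monomial except
those in the cubes (`eval_eq_sum_orbitSum`). Below degree 9 the survivors are symmetric in the two
coordinates, so `(1, y, 0)` and `(y, 1, 0)` are not told apart, while `x⁶y³ + y⁶z³ + z⁶x³` separates
them when `y ≠ 0` and `y³ ≠ 1`. Such a `y` exists unless `|K| = 4`. For `|K| = 4` all cubes are 0 or
1, so degree 6 suffices on `V₀`, and `(0, 0, 0)`, `(1, 1, 0)` need degree 6 because `1 + 1 = 0`. -/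

theorem eval_polyAct (ψ : G →* GL (Fin n) K) (g : G) (f : MvPolynomial (Fin n) K)
    (v : Fin n → K) :
    eval v (polyAct ψ g f) = eval ((ψ g⁻¹ : Matrix (Fin n) (Fin n) K).mulVec v) f := by
  have h : ((aeval v : MvPolynomial (Fin n) K →ₐ[K] K).comp (polyAct ψ g)) =
      aeval ((ψ g⁻¹ : Matrix (Fin n) (Fin n) K).mulVec v) := by
    ext j
    simp [polyAct, Matrix.mulVec, dotProduct]
  simpa [aeval_eq_eval] using DFunLike.congr_fun h f

theorem polyAct_one (ψ : G →* GL (Fin n) K) (f : MvPolynomial (Fin n) K) :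
    polyAct ψ 1 f = f := by
  have h : polyAct ψ 1 = AlgHom.id K (MvPolynomial (Fin n) K) := by
    apply MvPolynomial.algHom_ext
    intro j
    simp [polyAct, Matrix.one_apply]
  rw [h, AlgHom.id_apply]

theorem polyAct_mul (ψ : G →* GL (Fin n) K) (g h : G) (f : MvPolynomial (Fin n) K) :
    polyAct ψ (g * h) f = polyAct ψ g (polyAct ψ h f) := by
  have key : polyAct ψ (g * h) = (polyAct ψ g).comp (polyAct ψ h) := by
    apply MvPolynomial.algHom_ext
    intro j
    simp only [polyAct, mul_inv_rev, map_mul, Units.val_mul, Matrix.mul_apply, aeval_X, map_sum,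
      AlgHom.coe_comp, Function.comp_apply, algHom_C, algebraMap_eq, Finset.sum_mul,
      Finset.mul_sum, mul_assoc]
    exact Finset.sum_comm
  rw [key, AlgHom.comp_apply]

theorem mem_invariants {ψ : G →* GL (Fin n) K} {f : MvPolynomial (Fin n) K} :
    f ∈ invariants ψ ↔ ∀ g, polyAct ψ g f = f := by
  simp [invariants, Algebra.mem_iInf, AlgHom.mem_equalizer]

theorem mem_invariants_of_closure {ψ : G →* GL (Fin n) K} {f : MvPolynomial (Fin n) K}
    {s : Set G} (hs : Subgroup.closure s = ⊤) (h : ∀ g ∈ s, polyAct ψ g f = f) :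
    f ∈ invariants ψ := by
  rw [mem_invariants]
  intro g
  have hg : g ∈ Subgroup.closure s := hs ▸ Subgroup.mem_top g
  induction hg using Subgroup.closure_induction with
  | mem x hx => exact h x hx
  | one => exact polyAct_one ψ f
  | mul x y _ _ hx hy => rw [polyAct_mul, hy, hx]
  | inv x _ hx => nth_rewrite 1 [← hx]; rw [← polyAct_mul, inv_mul_cancel, polyAct_one]

theorem eval_mulVec_of_mem_invariants {ψ : G →* GL (Fin n) K} {f : MvPolynomial (Fin n) K}
    (hf : f ∈ invariants ψ) (g : G) (v : Fin n → K) :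
    eval ((ψ g : Matrix (Fin n) (Fin n) K).mulVec v) f = eval v f := by
  have h := eval_polyAct ψ g⁻¹ f v
  rw [mem_invariants.1 hf, inv_inv] at h
  exact h.symm

theorem totalDegree_add_le {f g : MvPolynomial (Fin n) K} {d : ℕ} (hf : f.totalDegree ≤ d)
    (hg : g.totalDegree ≤ d) : (f + g).totalDegree ≤ d :=
  (totalDegree_add f g).trans (max_le hf hg)

theorem totalDegree_mul_le {f g : MvPolynomial (Fin n) K} {d e : ℕ} (hf : f.totalDegree ≤ d)
    (hg : g.totalDegree ≤ e) : (f * g).totalDegree ≤ d + e :=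
  (totalDegree_mul f g).trans (add_le_add hf hg)

theorem totalDegree_pow_le {f : MvPolynomial (Fin n) K} {d : ℕ} (hf : f.totalDegree ≤ d)
    (k : ℕ) : (f ^ k).totalDegree ≤ k * d :=
  (totalDegree_pow f k).trans (Nat.mul_le_mul_left k hf)

theorem totalDegree_C_mul_le {f : MvPolynomial (Fin n) K} {d : ℕ} (hf : f.totalDegree ≤ d)
    (t : K) : (C t * f).totalDegree ≤ d := by
  simpa using totalDegree_mul_le (totalDegree_C (σ := Fin n) t).le hf

theorem totalDegree_sub_C_le {f : MvPolynomial (Fin n) K} {d : ℕ} (hf : f.totalDegree ≤ d)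
    (t : K) : (f - C t).totalDegree ≤ d :=
  (totalDegree_sub f (C t)).trans (max_le hf (by simp))

theorem totalDegree_polyAct_le (ψ : G →* GL (Fin n) K) (g : G) {f : MvPolynomial (Fin n) K}
    {d : ℕ} (hf : f.totalDegree ≤ d) : (polyAct ψ g f).totalDegree ≤ d := by
  rw [← MvPolynomial.sum_homogeneousComponent f, map_sum]
  refine totalDegree_finsetSum_le fun i hi => ?_
  have hlin : ∀ j : Fin n,
      (∑ i, C ((ψ g⁻¹ : Matrix (Fin n) (Fin n) K) j i) * X i :
        MvPolynomial (Fin n) K).IsHomogeneous 1 := fun j =>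
    IsHomogeneous.sum _ _ _ fun i _ => by
      simpa using (isHomogeneous_C (Fin n) _).mul (isHomogeneous_X K i)
  have h := (homogeneousComponent_isHomogeneous i f).aeval
    (fun j => ∑ i, C ((ψ g⁻¹ : Matrix (Fin n) (Fin n) K) j i) * X i) hlin
  refine h.totalDegree_le.trans ?_
  rw [Finset.mem_range] at hi
  omega

/-- Two points on which all invariants of degree at most `d` agree. -/
def Agree (ψ : G →* GL (Fin n) K) (d : ℕ) (v w : Fin n → K) : Prop :=
  ∀ f ∈ invariants ψ, f.totalDegree ≤ d → eval v f = eval w f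

/-- Two points in the same orbit. -/
def SameOrbit (ψ : G →* GL (Fin n) K) (v w : Fin n → K) : Prop :=
  ∃ g : G, (ψ g : Matrix (Fin n) (Fin n) K).mulVec v = w

/-- The result of moving a point by the inverse of a group element, so that
`eval (move ψ g v) f = eval v (polyAct ψ g f)`. -/
def move (ψ : G →* GL (Fin n) K) (g : G) (v : Fin n → K) : Fin n → K :=
  (ψ g⁻¹ : Matrix (Fin n) (Fin n) K).mulVec v

theorem eval_move (ψ : G →* GL (Fin n) K) (g : G) (v : Fin n → K) (f : MvPolynomial (Fin n) K) :
    eval (move ψ g v) f = eval v (polyAct ψ g f) :=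
  (eval_polyAct ψ g f v).symm

variable {ψ : G →* GL (Fin n) K} {d : ℕ} {v w : Fin n → K}

theorem Agree.symm (h : Agree ψ d v w) : Agree ψ d w v := fun f hf hd => (h f hf hd).symm

theorem Agree.move_left (h : Agree ψ d v w) (g : G) : Agree ψ d (move ψ g v) w :=
  fun f hf hd => by rw [eval_move, mem_invariants.1 hf, h f hf hd]

theorem Agree.move_right (h : Agree ψ d v w) (g : G) : Agree ψ d v (move ψ g w) :=
  (h.symm.move_left g).symm

theorem SameOrbit.refl (ψ : G →* GL (Fin n) K) (v : Fin n → K) : SameOrbit ψ v v :=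
  ⟨1, by simp⟩

theorem SameOrbit.symm (h : SameOrbit ψ v w) : SameOrbit ψ w v := by
  obtain ⟨g, rfl⟩ := h
  refine ⟨g⁻¹, ?_⟩
  rw [Matrix.mulVec_mulVec, ← Units.val_mul, ← map_mul, inv_mul_cancel]
  simp

theorem SameOrbit.trans {u : Fin n → K} (h : SameOrbit ψ v w) (h' : SameOrbit ψ w u) :
    SameOrbit ψ v u := by
  obtain ⟨g, rfl⟩ := h
  obtain ⟨g', rfl⟩ := h'
  refine ⟨g' * g, ?_⟩
  rw [Matrix.mulVec_mulVec, map_mul, Units.val_mul]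

theorem sameOrbit_move (ψ : G →* GL (Fin n) K) (g : G) (v : Fin n → K) :
    SameOrbit ψ v (move ψ g v) := ⟨g⁻¹, rfl⟩

theorem SameOrbit.of_move_left (g : G) (h : SameOrbit ψ (move ψ g v) w) : SameOrbit ψ v w :=
  (sameOrbit_move ψ g v).trans h

theorem SameOrbit.of_move_right (g : G) (h : SameOrbit ψ v (move ψ g w)) : SameOrbit ψ v w :=
  h.trans (sameOrbit_move ψ g w).symm

theorem orbit_eq_iff : orbit ψ v = orbit ψ w ↔ SameOrbit ψ v w := by
  constructor
  · intro h
    have hw : w ∈ orbit ψ v := h ▸ ⟨1, by simp⟩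
    exact hw
  · intro h
    ext u
    exact ⟨fun hu => SameOrbit.trans h.symm hu, fun hu => SameOrbit.trans h hu⟩

theorem isSeparating_iff :
    IsSeparating ψ {f | f ∈ invariants ψ ∧ f.totalDegree ≤ d} ↔
      ∀ v w, Agree ψ d v w → SameOrbit ψ v w := by
  constructor
  · intro h v w hvw
    by_contra hc
    obtain ⟨f, ⟨hf, hd⟩, hne⟩ := h v w (mt orbit_eq_iff.1 hc)
    exact hne (hvw f hf hd)
  · intro h v w hvw
    by_contra! hc
    exact hvw (orbit_eq_iff.2 (h v w fun f hf hd => hc f ⟨hf, hd⟩))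

theorem betaSepRep_le (hd : 0 < d) (h : ∀ v w, Agree ψ d v w → SameOrbit ψ v w) :
    betaSepRep ψ ≤ d :=
  sInf_le ⟨d, hd, rfl, isSeparating_iff.2 h⟩

theorem le_betaSepRep (h : Agree ψ d v w) (h' : ¬ SameOrbit ψ v w) :
    ((d + 1 : ℕ) : ℕ∞) ≤ betaSepRep ψ := by
  refine le_sInf ?_
  rintro e ⟨k, _, rfl, hk⟩
  rw [isSeparating_iff] at hk
  by_contra hlt
  rw [not_le, Nat.cast_lt] at hlt
  exact h' (hk v w fun f hf hfd => h f hf (by omega))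

end Basic

/-! ### Eigenvectors for elements of order three -/

section Weights

variable {K : Type*} [Field K] {G : Type*} [Group G] {n : ℕ}

/-- `f` is an eigenvector of `g` with eigenvalue `ω ^ i`. -/
def Wt (ω : K) (ψ : G →* GL (Fin n) K) (g : G) (i : ℕ) (f : MvPolynomial (Fin n) K) : Prop :=
  polyAct ψ g f = C (ω ^ i) * f

variable {ω : K} {ψ : G →* GL (Fin n) K} {g : G} {i j : ℕ} {f f' : MvPolynomial (Fin n) K}

theorem pow_eq_pow_of_modEq (hω : ω ^ 3 = 1) (h : i % 3 = j % 3) : ω ^ i = ω ^ j := by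
  rw [pow_eq_pow_mod i hω, pow_eq_pow_mod j hω, h]

theorem Wt.congr (hω : ω ^ 3 = 1) (hf : Wt ω ψ g i f) (h : i % 3 = j % 3) : Wt ω ψ g j f := by
  rw [Wt, ← pow_eq_pow_of_modEq hω h]
  exact hf

theorem Wt.mul (hf : Wt ω ψ g i f) (hf' : Wt ω ψ g j f') : Wt ω ψ g (i + j) (f * f') := by
  rw [Wt] at *
  rw [map_mul, hf, hf', pow_add, C_mul]
  ring

theorem Wt.pow (hf : Wt ω ψ g i f) (k : ℕ) : Wt ω ψ g (k * i) (f ^ k) := by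
  rw [Wt] at *
  rw [map_pow, hf, mul_pow, ← C_pow, ← pow_mul, mul_comm k]

theorem Wt.add (hf : Wt ω ψ g i f) (hf' : Wt ω ψ g i f') : Wt ω ψ g i (f + f') := by
  rw [Wt] at *
  rw [map_add, hf, hf', mul_add]

theorem Wt.C_mul (hf : Wt ω ψ g i f) (t : K) : Wt ω ψ g i (C t * f) := by
  rw [Wt] at *
  rw [map_mul, hf, algHom_C, algebraMap_eq]
  ring

theorem Wt.sub_C (hf : Wt ω ψ g 0 f) (t : K) : Wt ω ψ g 0 (f - C t) := by
  rw [Wt] at *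
  rw [map_sub, hf, algHom_C, algebraMap_eq]
  simp

theorem Wt.eq_self (hω : ω ^ 3 = 1) (hf : Wt ω ψ g i f) (h : i % 3 = 0) : polyAct ψ g f = f := by
  have := hf.congr hω (j := 0) h
  simpa [Wt] using this

theorem Wt.eval_move (hf : Wt ω ψ g i f) (v : Fin n → K) :
    eval (move ψ g v) f = ω ^ i * eval v f := by
  rw [SepInv.eval_move, hf, eval_mul, eval_C]

theorem one_add_add_sq (hω : IsPrimitiveRoot ω 3) : 1 + ω + ω ^ 2 = 0 := by
  have := hω.geom_sum_eq_zero (by norm_num)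
  simpa [Finset.sum_range_succ] using this

theorem three_ne_zero_of_primitive (hω : IsPrimitiveRoot ω 3) : (3 : K) ≠ 0 := by
  have := hω.neZero'
  exact_mod_cast this.out

/-- As 3 is invertible, `f` is one third of the sum of its eigencomponents `f + ω²ⁱ g f + ωⁱ g² f`,
all of which stay in the stable subspace `W`. -/
theorem le_of_forall_wt (hω : IsPrimitiveRoot ω 3) (hg : g ^ 3 = 1)
    {W N : Submodule K (MvPolynomial (Fin n) K)} (hW : ∀ f ∈ W, polyAct ψ g f ∈ W)
    (h : ∀ i < 3, ∀ f ∈ W, Wt ω ψ g i f → f ∈ N) : W ≤ N := by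
  intro f hf
  have h3 : (3 : K) ≠ 0 := three_ne_zero_of_primitive hω
  have h1 := one_add_add_sq hω
  have hw3 := hω.pow_eq_one
  have hC3 : (C ω : MvPolynomial (Fin n) K) ^ 3 = 1 := by rw [← C_pow, hw3, C_1]
  have hC1 : 1 + (C ω : MvPolynomial (Fin n) K) + C ω ^ 2 = 0 := by
    rw [← C_pow, ← C_1, ← C_add, ← C_add, h1, C_0]
  have hg3 : polyAct ψ g (polyAct ψ g (polyAct ψ g f)) = f := by
    rw [← polyAct_mul, ← polyAct_mul, ← pow_two, ← pow_succ, hg, polyAct_one]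
  set f1 := polyAct ψ g f with hf1
  set f2 := polyAct ψ g f1 with hf2
  have key : ∀ i < 3, f + ω ^ (2 * i) • f1 + ω ^ i • f2 ∈ N := by
    intro i hi
    refine h i hi _ ?_ ?_
    · exact W.add_mem (W.add_mem hf (W.smul_mem _ (hW _ hf))) (W.smul_mem _ (hW _ (hW _ hf)))
    · rw [Wt, map_add, map_add, map_smul, map_smul, hg3, ← hf1, ← hf2]
      simp only [smul_eq_C_mul, C_pow]
      have : (C ω : MvPolynomial (Fin n) K) ^ (3 * i) = 1 := by rw [pow_mul, hC3, one_pow]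
      linear_combination (-f1) * this
  have e : f = (3 : K)⁻¹ • ((f + ω ^ (2 * 0) • f1 + ω ^ 0 • f2) +
      (f + ω ^ (2 * 1) • f1 + ω ^ 1 • f2) + (f + ω ^ (2 * 2) • f1 + ω ^ 2 • f2)) := by
    rw [eq_inv_smul_iff₀ h3]
    simp only [smul_eq_C_mul, C_pow]
    have : (C 3 : MvPolynomial (Fin n) K) = 3 := map_ofNat C 3
    rw [this]
    linear_combination (-f1 - f2) * hC1 - f1 * C ω * hC3
  rw [e]
  exact N.smul_mem _ (N.add_mem (N.add_mem (key 0 (by norm_num)) (key 1 (by norm_num)))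
    (key 2 (by norm_num)))

end Weights

/-! ### Joint eigenvectors for the Heisenberg relations -/

section Triple

variable {K : Type*} [Field K] {G : Type*} [Group G] {n : ℕ}

/-- Generators satisfying the relations of the Heisenberg group of order `27`. -/
structure HeisTriple (a b c : G) : Prop where
  a3 : a ^ 3 = 1
  b3 : b ^ 3 = 1
  c3 : c ^ 3 = 1
  ab : a * b = b * a * c
  ac : a * c = c * a
  bc : b * c = c * b
  closure_eq : Subgroup.closure {a, b, c} = ⊤

variable {ω : K} {ψ : G →* GL (Fin n) K} {a b c : G} {v w : Fin n → K}

theorem HeisTriple.mem_invariants (T : HeisTriple a b c) {f : MvPolynomial (Fin n) K}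
    (ha : polyAct ψ a f = f) (hb : polyAct ψ b f = f) (hc : polyAct ψ c f = f) :
    f ∈ invariants ψ := by
  refine mem_invariants_of_closure T.closure_eq ?_
  rintro g (rfl | rfl | rfl)
  exacts [ha, hb, hc]

theorem HeisTriple.wt_c (T : HeisTriple a b c) {f : MvPolynomial (Fin n) K} {k : ℕ}
    (hc : Wt ω ψ c k f) : Wt ω ψ c k (polyAct ψ b f) := by
  rw [Wt] at *
  rw [← polyAct_mul, ← T.bc, polyAct_mul, hc, map_mul, algHom_C, algebraMap_eq]

theorem HeisTriple.wt_c_of_a (T : HeisTriple a b c) {f : MvPolynomial (Fin n) K} {k : ℕ}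
    (hc : Wt ω ψ c k f) : Wt ω ψ c k (polyAct ψ a f) := by
  rw [Wt] at *
  rw [← polyAct_mul, ← T.ac, polyAct_mul, hc, map_mul, algHom_C, algebraMap_eq]

/-- The relation `ab = bac` makes `b` shift the `a`-weight by the `c`-weight; this is what turns one
eigenvector into three coordinates. -/
theorem HeisTriple.wt_a (T : HeisTriple a b c) {f : MvPolynomial (Fin n) K} {i k : ℕ}
    (ha : Wt ω ψ a i f) (hc : Wt ω ψ c k f) : Wt ω ψ a (i + k) (polyAct ψ b f) := by
  rw [Wt] at *
  rw [← polyAct_mul, T.ab, polyAct_mul, polyAct_mul, hc, map_mul, ha, map_mul, map_mul]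
  simp only [algHom_C, algebraMap_eq, pow_add, C_mul]
  ring

theorem HeisTriple.b_b_b (T : HeisTriple a b c) (f : MvPolynomial (Fin n) K) :
    polyAct ψ b (polyAct ψ b (polyAct ψ b f)) = f := by
  rw [← polyAct_mul, ← polyAct_mul, ← pow_two, ← pow_succ, T.b3, polyAct_one]

theorem HeisTriple.sum_mem_invariants (T : HeisTriple a b c) {f : MvPolynomial (Fin n) K}
    (ha : polyAct ψ a f = f) (hc : polyAct ψ c f = f) :
    f + polyAct ψ b f + polyAct ψ b (polyAct ψ b f) ∈ invariants ψ := by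
  -- Taking 1 as the root makes every weight mean plain invariance.
  have ha0 : Wt (1 : K) ψ a 0 f := by simpa [Wt] using ha
  have hc0 : Wt (1 : K) ψ c 0 f := by simpa [Wt] using hc
  have ha1 := T.wt_a ha0 hc0
  have hc1 := T.wt_c hc0
  have ha2 := T.wt_a ha1 hc1
  have hc2 := T.wt_c hc1
  refine T.mem_invariants ?_ ?_ ?_
  · exact ((ha0.add ha1).add ha2).eq_self (one_pow 3) rfl
  · rw [map_add, map_add, T.b_b_b]
    ring
  · exact ((hc0.add hc1).add hc2).eq_self (one_pow 3) rfl

theorem HeisTriple.eval_sum_eq (T : HeisTriple a b c) (hω : ω ^ 3 = 1) {d : ℕ}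
    (h : Agree ψ d v w) {f : MvPolynomial (Fin n) K} {i k : ℕ} (ha : Wt ω ψ a i f)
    (hc : Wt ω ψ c k f) (hi : i % 3 = 0) (hk : k % 3 = 0) (hd : f.totalDegree ≤ d) :
    eval v f + eval v (polyAct ψ b f) + eval v (polyAct ψ b (polyAct ψ b f)) =
      eval w f + eval w (polyAct ψ b f) + eval w (polyAct ψ b (polyAct ψ b f)) := by
  have := h _ (T.sum_mem_invariants (ha.eq_self hω hi) (hc.eq_self hω hk))
    (totalDegree_add_le (totalDegree_add_le hd (totalDegree_polyAct_le ψ b hd))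
      (totalDegree_polyAct_le ψ b (totalDegree_polyAct_le ψ b hd)))
  simpa only [map_add] using this

/-- The eigenspace of `g` with eigenvalue `ω ^ i`. -/
noncomputable def wtSubmodule (ω : K) (ψ : G →* GL (Fin n) K) (g : G) (i : ℕ) :
    Submodule K (MvPolynomial (Fin n) K) where
  carrier := {f | Wt ω ψ g i f}
  zero_mem' := by simp [Wt]
  add_mem' := fun h h' => h.add h'
  smul_mem' := fun t f h => by
    rw [smul_eq_C_mul]
    exact h.C_mul t

/-- The polynomials of degree at most one. -/
noncomputable def linearForms (K : Type*) [Field K] (n : ℕ) : Submodule K (MvPolynomial (Fin n) K) :=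
  restrictTotalDegree (Fin n) K 1

theorem mem_linearForms {f : MvPolynomial (Fin n) K} :
    f ∈ linearForms K n ↔ f.totalDegree ≤ 1 := mem_restrictTotalDegree _ _ _

/-- The polynomials with the same value at `v` and `w`. -/
noncomputable def agreeSubmodule (v w : Fin n → K) : Submodule K (MvPolynomial (Fin n) K) :=
  LinearMap.eqLocus (aeval v : MvPolynomial (Fin n) K →ₐ[K] K).toLinearMap
    (aeval w : MvPolynomial (Fin n) K →ₐ[K] K).toLinearMap

theorem mem_agreeSubmodule {f : MvPolynomial (Fin n) K} :
    f ∈ agreeSubmodule v w ↔ eval v f = eval w f := by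
  simp [agreeSubmodule, LinearMap.mem_eqLocus, aeval_eq_eval]

theorem eq_of_linearForms_le (h : linearForms K n ≤ agreeSubmodule v w) : v = w := by
  ext i
  have := mem_agreeSubmodule.1 (h (mem_linearForms.2 (totalDegree_X (R := K) i).le))
  simpa using this

theorem linearForms_le_of_wt_c (T : HeisTriple a b c) (hω : IsPrimitiveRoot ω 3)
    {N : Submodule K (MvPolynomial (Fin n) K)}
    (h : ∀ k < 3, linearForms K n ⊓ wtSubmodule ω ψ c k ≤ N) : linearForms K n ≤ N :=
  le_of_forall_wt hω T.c3
    (fun _ hf => mem_linearForms.2 (totalDegree_polyAct_le ψ c (mem_linearForms.1 hf)))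
    (fun k hk _ hf hw => h k hk ⟨hf, hw⟩)

theorem linearForms_inf_le_of_wt_a (T : HeisTriple a b c) (hω : IsPrimitiveRoot ω 3) {k : ℕ}
    {N : Submodule K (MvPolynomial (Fin n) K)}
    (h : ∀ s < 3, ∀ f : MvPolynomial (Fin n) K, f.totalDegree ≤ 1 → Wt ω ψ c k f →
      Wt ω ψ a s f → f ∈ N) : linearForms K n ⊓ wtSubmodule ω ψ c k ≤ N :=
  le_of_forall_wt hω T.a3
    (fun _ hf => ⟨mem_linearForms.2 (totalDegree_polyAct_le ψ a (mem_linearForms.1 hf.1)),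
      T.wt_c_of_a hf.2⟩)
    (fun s hs f hf hw => h s hs f (mem_linearForms.1 hf.1) hf.2 hw)

theorem linearForms_inf_le_of_wt_b (T : HeisTriple a b c) (hω : IsPrimitiveRoot ω 3)
    {N : Submodule K (MvPolynomial (Fin n) K)}
    (h : ∀ s < 3, ∀ j < 3, ∀ f : MvPolynomial (Fin n) K, f.totalDegree ≤ 1 → Wt ω ψ c 0 f →
      Wt ω ψ a s f → Wt ω ψ b j f → f ∈ N) : linearForms K n ⊓ wtSubmodule ω ψ c 0 ≤ N := by
  refine linearForms_inf_le_of_wt_a T hω fun s hs f hd hc ha => ?_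
  have := le_of_forall_wt (ψ := ψ) hω T.b3 (N := N)
    (W := (linearForms K n ⊓ wtSubmodule ω ψ c 0) ⊓ wtSubmodule ω ψ a s)
    (fun f hf => ⟨⟨mem_linearForms.2 (totalDegree_polyAct_le ψ b (mem_linearForms.1 hf.1.1)),
      T.wt_c hf.1.2⟩, show Wt ω ψ a s _ by simpa only [add_zero] using T.wt_a hf.2 hf.1.2⟩)
    (fun j hj f hf hw => h s hs j hj f (mem_linearForms.1 hf.1.1) hf.1.2 hf.2 hw)
  exact this ⟨⟨mem_linearForms.2 hd, hc⟩, ha⟩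

theorem eq_of_forall_wt (T : HeisTriple a b c) (hω : IsPrimitiveRoot ω 3)
    (h : ∀ k < 3, ∀ s < 3, ∀ f : MvPolynomial (Fin n) K, f.totalDegree ≤ 1 → Wt ω ψ c k f →
      Wt ω ψ a s f → eval v f = eval w f) : v = w :=
  eq_of_linearForms_le <| linearForms_le_of_wt_c (ψ := ψ) T hω fun k hk =>
    linearForms_inf_le_of_wt_a T hω fun s hs f hd hc ha =>
      mem_agreeSubmodule.2 (h k hk s hs f hd hc ha)

theorem eq_of_forall_wt_b (T : HeisTriple a b c) (hω : IsPrimitiveRoot ω 3)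
    (h : ∀ k < 3, k ≠ 0 → ∀ f : MvPolynomial (Fin n) K, f.totalDegree ≤ 1 → ∀ s < 3,
      Wt ω ψ c k f → Wt ω ψ a s f → eval v f = eval w f)
    (h0 : ∀ s < 3, ∀ j < 3, ∀ f : MvPolynomial (Fin n) K, f.totalDegree ≤ 1 → Wt ω ψ c 0 f →
      Wt ω ψ a s f → Wt ω ψ b j f → eval v f = eval w f) : v = w := by
  refine eq_of_linearForms_le <| linearForms_le_of_wt_c (ψ := ψ) T hω fun k hk => ?_
  rcases eq_or_ne k 0 with rfl | hk0
  · exact linearForms_inf_le_of_wt_b T hω fun s hs j hj f hd hc ha hb =>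
      mem_agreeSubmodule.2 (h0 s hs j hj f hd hc ha hb)
  · exact linearForms_inf_le_of_wt_a T hω fun s hs f hd hc ha =>
      mem_agreeSubmodule.2 (h k hk hk0 f hd s hs hc ha)

theorem exists_eq_pow_mul (hω : IsPrimitiveRoot ω 3) {s t : K} (h : s ^ 3 = t ^ 3) :
    ∃ j < 3, t = ω ^ j * s := by
  rcases eq_or_ne s 0 with rfl | hs
  · refine ⟨0, by norm_num, ?_⟩
    have : t ^ 3 = 0 := by rw [← h]; norm_num
    simpa using this
  · have : (t / s) ^ 3 = 1 := by rw [div_pow, ← h, div_self (pow_ne_zero 3 hs)]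
    obtain ⟨j, hj, hj'⟩ := hω.eq_pow_of_pow_eq_one this
    exact ⟨j, hj, by rw [hj', div_mul_cancel₀ _ hs]⟩

theorem Wt.elem_mul {g h : G} {i j : ℕ} {f : MvPolynomial (Fin n) K} (hg : Wt ω ψ g i f)
    (hh : Wt ω ψ h j f) : Wt ω ψ (g * h) (i + j) f := by
  rw [Wt] at *
  rw [polyAct_mul, hh, map_mul (polyAct ψ g), hg, algHom_C, algebraMap_eq, pow_add, MvPolynomial.C_mul]
  ring

theorem Wt.elem_pow {g : G} {i : ℕ} {f : MvPolynomial (Fin n) K} (hg : Wt ω ψ g i f) (m : ℕ) :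
    Wt ω ψ (g ^ m) (m * i) f := by
  induction m with
  | zero => simp [Wt, polyAct_one]
  | succ m ih =>
    rw [pow_succ, add_mul, one_mul]
    exact ih.elem_mul hg

/-- Three polynomials of degree at most one that span a copy of the three-dimensional
representation. -/
structure Coords (ω : K) (ψ : G →* GL (Fin n) K) (a b c : G) (x y z : MvPolynomial (Fin n) K) :
    Prop where
  dx : x.totalDegree ≤ 1
  dy : y.totalDegree ≤ 1
  dz : z.totalDegree ≤ 1
  ax : Wt ω ψ a 0 x
  ay : Wt ω ψ a 1 y
  az : Wt ω ψ a 2 z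
  cx : Wt ω ψ c 1 x
  cy : Wt ω ψ c 1 y
  cz : Wt ω ψ c 1 z
  bx : polyAct ψ b x = y
  bY : polyAct ψ b y = z
  bz : polyAct ψ b z = x

theorem HeisTriple.coords (T : HeisTriple a b c) {x : MvPolynomial (Fin n) K}
    (hd : x.totalDegree ≤ 1) (ha : Wt ω ψ a 0 x) (hc : Wt ω ψ c 1 x) :
    Coords ω ψ a b c x (polyAct ψ b x) (polyAct ψ b (polyAct ψ b x)) where
  dx := hd
  dy := totalDegree_polyAct_le ψ b hd
  dz := totalDegree_polyAct_le ψ b (totalDegree_polyAct_le ψ b hd)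
  ax := ha
  ay := by simpa only [zero_add] using T.wt_a ha hc
  az := by simpa only [zero_add, one_add_one_eq_two] using T.wt_a (T.wt_a ha hc) (T.wt_c hc)
  cx := hc
  cy := T.wt_c hc
  cz := T.wt_c (T.wt_c hc)
  bx := rfl
  bY := rfl
  bz := T.b_b_b x

variable {x y z : MvPolynomial (Fin n) K}

/-! #### Two coordinates vanish -/

/-- In the sum of the `b`-translates of `xʳq` the two shifted terms contain `yʳ` or `zʳ` with `r >
0` and vanish, so `q(v)` can be read off. The exponent `r ≤ 3` only has to cancel the `c`-weight,
since `a` fixes `x`. -/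
theorem eval_eq_of_two_zero (T : HeisTriple a b c) (hω : IsPrimitiveRoot ω 3)
    (S : Coords ω ψ a b c x y z) (h : Agree ψ 9 v w) (hx : eval w x = eval v x)
    (hx0 : eval v x ≠ 0) (hy : eval v y = 0) (hz : eval v z = 0) (hy' : eval w y = 0)
    (hz' : eval w z = 0) {q : MvPolynomial (Fin n) K} {k s : ℕ} (hd : q.totalDegree ≤ 6)
    (hc : Wt ω ψ c k q) (ha : Wt ω ψ a s q) (hs : s % 3 = 0) : eval v q = eval w q := by
  obtain ⟨r, hr0, hr3, hr⟩ : ∃ r, r ≠ 0 ∧ r ≤ 3 ∧ (r * 1 + k) % 3 = 0 :=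
    ⟨3 - k % 3, by omega, by omega, by omega⟩
  have key := T.eval_sum_eq hω.pow_eq_one h ((S.ax.pow r).mul ha) ((S.cx.pow r).mul hc)
    (by omega) hr
    ((totalDegree_mul_le (totalDegree_pow_le S.dx r) hd).trans (by omega))
  simp only [map_mul, map_pow, S.bx, S.bY, hx, hy, hz, hy', hz', zero_pow hr0, zero_mul,
    add_zero] at key
  exact mul_left_cancel₀ (pow_ne_zero r hx0) key

/-- Powers of `a` preserve the coordinates `(x, 0, 0)`, so the question reduces to separating orbits
of a cyclic group of order 3: cubes `l³` and products `q lʳ` with `r ≤ 2` do this. -/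
theorem sameOrbit_of_two_zero (T : HeisTriple a b c) (hω : IsPrimitiveRoot ω 3)
    (S : Coords ω ψ a b c x y z) (h : Agree ψ 9 v w) (hx : eval w x = eval v x)
    (hx0 : eval v x ≠ 0) (hy : eval v y = 0) (hz : eval v z = 0) (hy' : eval w y = 0)
    (hz' : eval w z = 0) : SameOrbit ψ v w := by
  by_cases hall : ∀ k < 3, ∀ s < 3, ∀ f : MvPolynomial (Fin n) K, f.totalDegree ≤ 1 →
      Wt ω ψ c k f → Wt ω ψ a s f → eval v f = eval w f
  · rw [eq_of_forall_wt T hω hall]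
    exact SameOrbit.refl ψ w
  push Not at hall
  obtain ⟨k, hk, s, hs, l, hd, hc, ha, hne⟩ := hall
  have hs0 : s ≠ 0 := by
    rintro rfl
    exact hne (eval_eq_of_two_zero T hω S h hx hx0 hy hz hy' hz' (by omega) hc ha rfl)
  have hcube := eval_eq_of_two_zero T hω S h hx hx0 hy hz hy' hz'
    ((totalDegree_pow_le hd 3).trans (by norm_num)) (hc.pow 3) (ha.pow 3) (by omega)
  rw [map_pow, map_pow] at hcube
  obtain ⟨j, hj, hjw⟩ := exists_eq_pow_mul hω hcube
  have hl0 : eval v l ≠ 0 := fun h0 => hne (by rw [hjw, h0, mul_zero])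
  -- This multiplies `l` by `ω ^ (s * j * s)`, which is `ω ^ j` because `s² ≡ 1` modulo 3.
  refine SameOrbit.of_move_left (a ^ (s * j)) ?_
  have h' := h.move_left (a ^ (s * j))
  have hx1 := (S.ax.elem_pow (s * j)).eval_move v
  have hy1 := (S.ay.elem_pow (s * j)).eval_move v
  have hz1 := (S.az.elem_pow (s * j)).eval_move v
  have hl1 := (ha.elem_pow (s * j)).eval_move v
  rw [mul_zero, pow_zero, one_mul] at hx1
  rw [hy, mul_zero] at hy1
  rw [hz, mul_zero] at hz1
  rw [pow_eq_pow_of_modEq hω.pow_eq_one (j := j) (by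
    obtain rfl | rfl : s = 1 ∨ s = 2 := by omega
    all_goals omega), ← hjw] at hl1
  rw [← hx1] at hx hx0
  set u := move ψ (a ^ (s * j)) v
  have hlw : eval w l ≠ 0 := by
    rw [hjw]
    exact mul_ne_zero (pow_ne_zero j (hω.ne_zero (by norm_num))) hl0
  suffices hu : u = w by rw [hu]; exact SameOrbit.refl ψ w
  refine eq_of_forall_wt (ψ := ψ) T hω fun k' _ s' hs' q hqd hqc hqa => ?_
  obtain ⟨r, hr, hr'⟩ : ∃ r ≤ 2, (s' + r * s) % 3 = 0 := by
    obtain rfl | rfl : s = 1 ∨ s = 2 := by omega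
    · exact ⟨(2 * s') % 3, by omega, by omega⟩
    · exact ⟨s', by omega, by omega⟩
  have key := eval_eq_of_two_zero T hω S h' hx hx0 hy1 hz1 hy' hz'
    ((totalDegree_mul_le hqd (totalDegree_pow_le hd r)).trans (by omega))
    (hqc.mul (hc.pow r)) (hqa.mul (ha.pow r)) hr'
  rw [map_mul, map_mul, map_pow, map_pow, hl1] at key
  exact mul_right_cancel₀ (pow_ne_zero r hlw) key

/-! #### One coordinate vanishes -/

/-- The shifts of `xⁱyʲ` under `b` contain a positive power of `z` and vanish at both points.
Exponents in `1, 2, 3` rather than `0, 1, 2` are chosen for this; they realise every pair of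
weights, in degree at most 7 including `q`. -/
theorem eq_of_one_zero (T : HeisTriple a b c) (hω : IsPrimitiveRoot ω 3)
    (S : Coords ω ψ a b c x y z) (h : Agree ψ 9 v w) (hx : eval w x = eval v x)
    (hy : eval w y = eval v y) (hx0 : eval v x ≠ 0) (hy0 : eval v y ≠ 0) (hz : eval v z = 0)
    (hz' : eval w z = 0) : v = w := by
  refine eq_of_forall_wt (ψ := ψ) T hω fun k _ s _ q hqd hqc hqa => ?_
  obtain ⟨j, hj0, hj3, hj⟩ : ∃ r, r ≠ 0 ∧ r ≤ 3 ∧ (r + s) % 3 = 0 :=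
    ⟨3 - s % 3, by omega, by omega, by omega⟩
  obtain ⟨i, hi0, hi3, hi⟩ : ∃ r, r ≠ 0 ∧ r ≤ 3 ∧ (r + j + k) % 3 = 0 :=
    ⟨3 - (j + k) % 3, by omega, by omega, by omega⟩
  have key := T.eval_sum_eq hω.pow_eq_one h (((S.ax.pow i).mul (S.ay.pow j)).mul hqa)
    (((S.cx.pow i).mul (S.cy.pow j)).mul hqc) (by omega) (by omega)
    ((totalDegree_mul_le (totalDegree_mul_le (totalDegree_pow_le S.dx i)
      (totalDegree_pow_le S.dy j)) hqd).trans (by omega))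
  simp only [map_mul, map_pow, S.bx, S.bY, S.bz, hx, hy, hz, hz', zero_pow hi0, zero_pow hj0,
    zero_mul, mul_zero, add_zero] at key
  exact mul_left_cancel₀ (mul_ne_zero (pow_ne_zero i hx0) (pow_ne_zero j hy0)) key

end Triple

/-! ### Other generating triples of the Heisenberg group -/

section Twist

variable {G : Type*} [Group G] {a b c : G}

theorem closure_eq_top_of_mem {s t : Set G} (hs : Subgroup.closure s = ⊤)
    (h : ∀ g ∈ s, g ∈ Subgroup.closure t) : Subgroup.closure t = ⊤ :=
  top_le_iff.1 (hs ▸ (Subgroup.closure_le _).2 h)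

theorem HeisTriple.mul_c (T : HeisTriple a b c) : HeisTriple (a * c) b c where
  a3 := by rw [(show Commute a c from T.ac).mul_pow, T.a3, T.c3, one_mul]
  b3 := T.b3
  c3 := T.c3
  ab := by rw [mul_assoc, ← T.bc, ← mul_assoc, T.ab]; simp only [mul_assoc]
  ac := by rw [← mul_assoc, ← T.ac]
  bc := T.bc
  closure_eq := by
    refine closure_eq_top_of_mem T.closure_eq ?_
    have ha : a * c ∈ Subgroup.closure {a * c, b, c} := Subgroup.subset_closure (by simp)
    have hb : b ∈ Subgroup.closure {a * c, b, c} := Subgroup.subset_closure (by simp)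
    have hc : c ∈ Subgroup.closure {a * c, b, c} := Subgroup.subset_closure (by simp)
    rintro g (rfl | rfl | rfl)
    · simpa using Subgroup.mul_mem _ ha (Subgroup.inv_mem _ hc)
    · exact hb
    · exact hc

theorem HeisTriple.mul_b (T : HeisTriple a b c) : HeisTriple (a * b) b c where
  a3 := by
    have hba : b * a = a * b * c⁻¹ := by rw [T.ab, mul_inv_cancel_right]
    have hc : ∀ g, c⁻¹ * (b * g) = b * (c⁻¹ * g) := fun g => by
      rw [← mul_assoc, ← mul_assoc, (show Commute b c from T.bc).inv_right.eq]
    have hc' : ∀ g, c⁻¹ * (a * g) = a * (c⁻¹ * g) := fun g => by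
      rw [← mul_assoc, ← mul_assoc, (show Commute a c from T.ac).inv_right.eq]
    have hba' : ∀ g, b * (a * g) = a * (b * (c⁻¹ * g)) := fun g => by
      rw [← mul_assoc, hba]; simp only [mul_assoc]
    have ha3 : ∀ g, a * (a * (a * g)) = g := fun g => by
      rw [← mul_assoc, ← mul_assoc, ← pow_two, ← pow_succ, T.a3, one_mul]
    have hb3 : ∀ g, b * (b * (b * g)) = g := fun g => by
      rw [← mul_assoc, ← mul_assoc, ← pow_two, ← pow_succ, T.b3, one_mul]
    have hc3 : c⁻¹ * (c⁻¹ * c⁻¹) = 1 := by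
      rw [← mul_inv_rev, ← mul_inv_rev, ← pow_two, ← pow_succ, T.c3, inv_one]
    rw [pow_succ, pow_two, ← mul_one (a * b * (a * b) * (a * b))]
    simp only [mul_assoc, hba', hc, hc', ha3, hb3]
    simp only [mul_one, hc3]
  b3 := T.b3
  c3 := T.c3
  ab := by
    calc a * b * b = b * a * (c * b) := by rw [T.ab, mul_assoc]
      _ = b * (a * b) * c := by rw [← T.bc]; simp only [mul_assoc]
  ac := by rw [mul_assoc, T.bc, ← mul_assoc, T.ac, mul_assoc]
  bc := T.bc
  closure_eq := by
    refine closure_eq_top_of_mem T.closure_eq ?_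
    have ha : a * b ∈ Subgroup.closure {a * b, b, c} := Subgroup.subset_closure (by simp)
    have hb : b ∈ Subgroup.closure {a * b, b, c} := Subgroup.subset_closure (by simp)
    have hc : c ∈ Subgroup.closure {a * b, b, c} := Subgroup.subset_closure (by simp)
    rintro g (rfl | rfl | rfl)
    · simpa using Subgroup.mul_mem _ ha (Subgroup.inv_mem _ hb)
    · exact hb
    · exact hc

theorem HeisTriple.rotate (T : HeisTriple a b c) : HeisTriple b⁻¹ a c where
  a3 := by rw [inv_pow, T.b3, inv_one]
  b3 := T.a3
  c3 := T.c3
  ab := by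
    have hbc : b⁻¹ * c = c * b⁻¹ := ((show Commute b c from T.bc).inv_left).eq
    rw [inv_mul_eq_iff_eq_mul, mul_assoc a, hbc, ← mul_assoc, ← mul_assoc, ← T.ab,
      mul_inv_cancel_right]
  ac := ((show Commute b c from T.bc).inv_left).eq
  bc := T.ac
  closure_eq := by
    refine closure_eq_top_of_mem T.closure_eq ?_
    have ha : a ∈ Subgroup.closure {b⁻¹, a, c} := Subgroup.subset_closure (by simp)
    have hb : b⁻¹ ∈ Subgroup.closure {b⁻¹, a, c} := Subgroup.subset_closure (by simp)
    have hc : c ∈ Subgroup.closure {b⁻¹, a, c} := Subgroup.subset_closure (by simp)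
    rintro g (rfl | rfl | rfl)
    · exact ha
    · simpa using Subgroup.inv_mem _ hb
    · exact hc

/-- A vector whose coordinates have equal nonzero cubes is fixed by an element of this form, which
can thereby take over the role of `a`. -/
theorem HeisTriple.twist (T : HeisTriple a b c) (s t : ℕ) :
    HeisTriple (b⁻¹ * a ^ s * c ^ t) a c := by
  have h : HeisTriple (b⁻¹ * a ^ s) a c := by
    induction s with
    | zero => simpa using T.rotate
    | succ s ih => simpa only [pow_succ, mul_assoc] using ih.mul_b
  induction t with
  | zero => simpa using h
  | succ t ih => simpa only [pow_succ, mul_assoc] using ih.mul_c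

end Twist

section Generic

variable {K : Type*} [Field K] {G : Type*} [Group G] {n : ℕ}
variable {ω : K} {ψ : G →* GL (Fin n) K} {a b c : G} {v w : Fin n → K}
variable {x y z : MvPolynomial (Fin n) K}

/-! #### All coordinates have the same nonzero cube -/

/-- In an eigenbasis of an element fixing `(x, y, z)`, two of the three new coordinates vanish,
which is the case already settled. -/
theorem sameOrbit_of_cubes_eq (T : HeisTriple a b c) (hω : IsPrimitiveRoot ω 3)
    (S : Coords ω ψ a b c x y z) (h : Agree ψ 9 v w) (hx : eval w x = eval v x)
    (hy : eval w y = eval v y) (hz : eval w z = eval v z) (hx0 : eval v x ≠ 0)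
    (hxy : eval v x ^ 3 = eval v y ^ 3) (hxz : eval v x ^ 3 = eval v z ^ 3) :
    SameOrbit ψ v w := by
  obtain ⟨p, -, hp⟩ := exists_eq_pow_mul hω hxy
  obtain ⟨q, -, hq⟩ := exists_eq_pow_mul hω hxz
  have hw3 := hω.pow_eq_one
  -- With these exponents the three summands of `x'` below all take the value `x(v)`, while its
  -- translates under `a` take the value `(1 + ω + ω²) x(v) = 0`.
  set t := 2 * q with ht
  set s := p + q with hs
  have T' := T.twist s t
  have hb : ∀ f, polyAct ψ b⁻¹ (polyAct ψ b f) = f := fun f => by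
    rw [← polyAct_mul, inv_mul_cancel, polyAct_one]
  have hbx : polyAct ψ b⁻¹ x = z := by rw [← S.bz, hb]
  have hby : polyAct ψ b⁻¹ y = x := by rw [← S.bx, hb]
  have hbz : polyAct ψ b⁻¹ z = y := by rw [← S.bY, hb]
  have hact : ∀ i f, Wt ω ψ a i f → Wt ω ψ c 1 f →
      polyAct ψ (b⁻¹ * a ^ s * c ^ t) f = C (ω ^ (s * i + t)) * polyAct ψ b⁻¹ f := by
    intro i f ha hc
    have h1 := (ha.elem_pow s).elem_mul (hc.elem_pow t)
    rw [Wt] at h1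
    rw [mul_assoc, polyAct_mul, h1, map_mul, algHom_C, algebraMap_eq, mul_one]
  have hax := hact 0 x S.ax S.cx
  have hay := hact 1 y S.ay S.cy
  have haz := hact 2 z S.az S.cz
  rw [hbx] at hax
  rw [hby] at hay
  rw [hbz] at haz
  have hC : ∀ i j, i % 3 = j % 3 → (C (ω ^ i) : MvPolynomial (Fin n) K) = C (ω ^ j) :=
    fun i j hij => by rw [pow_eq_pow_of_modEq hw3 hij]
  set x' := x + C (ω ^ t) * z + C (ω ^ (2 * t + 2 * s)) * y with hx'
  have hd : x'.totalDegree ≤ 1 := totalDegree_add_le (totalDegree_add_le S.dx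
    (totalDegree_C_mul_le S.dz _)) (totalDegree_C_mul_le S.dy _)
  have ha' : Wt ω ψ (b⁻¹ * a ^ s * c ^ t) 0 x' := by
    rw [Wt, hx', map_add, map_add, map_mul, map_mul, hax, hay, haz, algHom_C, algHom_C,
      algebraMap_eq, ← mul_assoc, ← mul_assoc, ← C_mul, ← C_mul, ← pow_add, ← pow_add,
      hC (t + (s * 2 + t)) (2 * t + 2 * s) (by omega),
      hC (2 * t + 2 * s + (s * 1 + t)) 0 (by omega), hC (s * 0 + t) t (by omega)]
    simp only [pow_zero, C_1, one_mul]
    ring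
  have hc' : Wt ω ψ c 1 x' := (S.cx.add (S.cz.C_mul _)).add (S.cy.C_mul _)
  have S' := T'.coords hd ha' hc'
  have e1 : polyAct ψ a x' = x + C (ω ^ (t + 2)) * z + C (ω ^ (2 * t + 2 * s + 1)) * y := by
    have h1 := S.ax
    have h2 := S.ay
    have h3 := S.az
    rw [Wt] at h1 h2 h3
    rw [hx', map_add, map_add, map_mul, map_mul, h1, h2, h3, algHom_C, algHom_C, algebraMap_eq]
    simp only [pow_add, C_mul, pow_zero, C_1]
    ring
  have e2 : polyAct ψ a (polyAct ψ a x') =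
      x + C (ω ^ (t + 1)) * z + C (ω ^ (2 * t + 2 * s + 2)) * y := by
    have h1 := S.ax
    have h2 := S.ay
    have h3 := S.az
    rw [Wt] at h1 h2 h3
    rw [e1, map_add, map_add, map_mul, map_mul, h1, h2, h3, algHom_C, algHom_C, algebraMap_eq,
      ← hC (t + 2 + 2) (t + 1) (by omega)]
    simp only [pow_add, C_mul, C_pow, pow_zero, C_1]
    ring
  have hval : ∀ i j, eval v (x + C (ω ^ (t + i)) * z + C (ω ^ (2 * t + 2 * s + j)) * y) =
      (1 + ω ^ i + ω ^ j) * eval v x := by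
    intro i j
    simp only [map_add, map_mul, eval_C, hp, hq]
    rw [← mul_assoc, ← mul_assoc, ← pow_add, ← pow_add,
      pow_eq_pow_of_modEq hw3 (show (t + i + q) % 3 = i % 3 by omega),
      pow_eq_pow_of_modEq hw3 (show (2 * t + 2 * s + j + p) % 3 = j % 3 by omega)]
    ring
  have hagree : ∀ i j, eval w (x + C (ω ^ i) * z + C (ω ^ j) * y) =
      eval v (x + C (ω ^ i) * z + C (ω ^ j) * y) := by
    intro i j
    simp only [map_add, map_mul, hx, hy, hz, eval_C]
  have h0 := one_add_add_sq hω
  have z1 : eval v (polyAct ψ a x') = 0 := by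
    rw [e1, hval]
    linear_combination eval v x * h0
  have z2 : eval v (polyAct ψ a (polyAct ψ a x')) = 0 := by
    rw [e2, hval]
    linear_combination eval v x * h0
  refine sameOrbit_of_two_zero T' hω S' h (hagree _ _) ?_ z1 z2 ?_ ?_
  · have := hval 0 0
    rw [add_zero, add_zero, ← hx'] at this
    rw [this]
    refine mul_ne_zero ?_ hx0
    convert three_ne_zero_of_primitive hω using 1
    norm_num
  · rw [e1, hagree, ← e1, z1]
  · rw [e2, hagree, ← e2, z2]

end Generic

section Generic

variable {K : Type*} [Field K] {G : Type*} [Group G] {n : ℕ}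
variable {ω : K} {ψ : G →* GL (Fin n) K} {a b c : G} {v w : Fin n → K}
variable {x y z : MvPolynomial (Fin n) K}

/-! #### All coordinates are nonzero, with different cubes -/

/-- The twisted cyclic sum of `f₀, f₁, f₂`. -/
noncomputable def cyc (ω : K) (f₀ f₁ f₂ : MvPolynomial (Fin n) K) (j : ℕ) :
    MvPolynomial (Fin n) K :=
  f₀ + C (ω ^ j) * f₁ + C (ω ^ (2 * j)) * f₂

variable {f₀ f₁ f₂ : MvPolynomial (Fin n) K}

theorem wt_cyc_b (hω : ω ^ 3 = 1) (h0 : polyAct ψ b f₀ = f₁) (h1 : polyAct ψ b f₁ = f₂)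
    (h2 : polyAct ψ b f₂ = f₀) (j : ℕ) : Wt ω ψ b (2 * j) (cyc ω f₀ f₁ f₂ j) := by
  have hC : (C ω : MvPolynomial (Fin n) K) ^ (3 * j) = 1 := by
    rw [pow_mul, ← C_pow, hω, C_1, one_pow]
  rw [Wt, cyc, map_add, map_add, map_mul, map_mul, h0, h1, h2, algHom_C, algHom_C, algebraMap_eq]
  simp only [C_pow]
  linear_combination (-f₁ - (C ω) ^ j * f₂) * hC

theorem Wt.cyc {g : G} {i : ℕ} (h0 : Wt ω ψ g i f₀) (h1 : Wt ω ψ g i f₁) (h2 : Wt ω ψ g i f₂)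
    (j : ℕ) : Wt ω ψ g i (cyc ω f₀ f₁ f₂ j) :=
  (h0.add (h1.C_mul _)).add (h2.C_mul _)

theorem totalDegree_cyc_le {d : ℕ} (h0 : f₀.totalDegree ≤ d) (h1 : f₁.totalDegree ≤ d)
    (h2 : f₂.totalDegree ≤ d) (j : ℕ) : (cyc ω f₀ f₁ f₂ j).totalDegree ≤ d :=
  totalDegree_add_le (totalDegree_add_le h0 (totalDegree_C_mul_le h1 _))
    (totalDegree_C_mul_le h2 _)

theorem eval_cyc (v : Fin n → K) (j : ℕ) : eval v (cyc ω f₀ f₁ f₂ j) =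
    eval v f₀ + ω ^ j * eval v f₁ + ω ^ (2 * j) * eval v f₂ := by
  simp [cyc]

/-- Two vanishing Fourier coefficients on `C₃` leave only the third, so `X, Y, Z` are proportional
to a character. -/
theorem eq_of_cyc_eq_zero (hω : IsPrimitiveRoot ω 3) {X Y Z e : K} (he : e ^ 3 = 1)
    (h1 : X + e * Y + e ^ 2 * Z = 0) (h2 : X + e * ω * Y + (e * ω) ^ 2 * Z = 0) :
    X = e * ω ^ 2 * Y ∧ e * Z = ω * Y := by
  have h0 := one_add_add_sq hω
  have h3 := hω.pow_eq_one
  have hne : 1 - ω ≠ 0 := sub_ne_zero.2 (hω.ne_one (by norm_num)).symm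
  have hen : e ≠ 0 := by
    rintro rfl
    norm_num at he
  have h4 : (1 - ω) * e * (Y + e * (1 + ω) * Z) = 0 := by linear_combination h1 - h2
  have h5 : Y + e * (1 + ω) * Z = 0 := by
    rcases mul_eq_zero.1 h4 with h | h
    · exact absurd h (mul_ne_zero hne hen)
    · exact h
  have h6 : e * Z = ω * Y := by linear_combination (-ω) * h5 + e * Z * h0
  exact ⟨by linear_combination h1 - e * h6 - e * Y * h0, h6⟩

theorem cube_eq_of_cyc_eq_zero (hω : IsPrimitiveRoot ω 3) (hy0 : eval v y ≠ 0)
    (hz0 : eval v z ≠ 0) {i j : ℕ} (hij : i % 3 ≠ j % 3)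
    (hi : eval v (cyc ω (x ^ 2 * y) (y ^ 2 * z) (z ^ 2 * x) i) = 0)
    (hj : eval v (cyc ω (x ^ 2 * y) (y ^ 2 * z) (z ^ 2 * x) j) = 0) :
    eval v x ^ 3 = eval v y ^ 3 := by
  -- Two distinct residues modulo 3 are consecutive in one of the two orders.
  wlog h : j % 3 = (i + 1) % 3 generalizing i j
  · exact this hij.symm hj hi (by omega)
  have h3 := hω.pow_eq_one
  rw [eval_cyc, pow_eq_pow_of_modEq h3 h,
    pow_eq_pow_of_modEq h3 (show (2 * j) % 3 = ((i + 1) * 2) % 3 by omega), pow_mul,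
    pow_succ ω i] at hj
  rw [eval_cyc, mul_comm 2 i, pow_mul] at hi
  have he : (ω ^ i) ^ 3 = 1 := by rw [← pow_mul, mul_comm, pow_mul, h3, one_pow]
  obtain ⟨h1, h2⟩ := eq_of_cyc_eq_zero hω he hi hj
  simp only [map_mul, map_pow] at h1 h2
  have h1' : eval v x ^ 2 = ω ^ i * ω ^ 2 * (eval v y * eval v z) :=
    mul_right_cancel₀ hy0 (by linear_combination h1)
  have h2' : ω ^ i * (eval v z * eval v x) = ω * eval v y ^ 2 :=
    mul_right_cancel₀ hz0 (by linear_combination h2)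
  linear_combination eval v x * h1' + ω ^ 2 * eval v y * h2' + eval v y ^ 3 * h3

/-- It suffices to multiply `q` by a semi-invariant of the inverse character that is nonzero at `v`.
The degree-3 semi-invariants `U i`, `P i` and their pairwise products supply one for every
nontrivial character: at most one `P i` vanishes at `v`, and not both `U 1` and `U 2` do, as either
failure would give `x³ = y³`. -/
theorem eq_of_generic_of_wt_zero (T : HeisTriple a b c) (hω : IsPrimitiveRoot ω 3)
    (S : Coords ω ψ a b c x y z) (h : Agree ψ 9 v w) (hx : eval w x = eval v x)
    (hy : eval w y = eval v y) (hz : eval w z = eval v z) (hy0 : eval v y ≠ 0)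
    (hz0 : eval v z ≠ 0) (hxy : eval v x ^ 3 ≠ eval v y ^ 3)
    {s j : ℕ} (hs : s < 3) (hj : j < 3) {q : MvPolynomial (Fin n) K} (hd : q.totalDegree ≤ 1)
    (hc : Wt ω ψ c 0 q) (ha : Wt ω ψ a s q) (hb : Wt ω ψ b j q) : eval v q = eval w q := by
  have h3 := hω.pow_eq_one
  have aux : ∀ (f : MvPolynomial (Fin n) K) (i₁ i₂ i₃ : ℕ), f.totalDegree ≤ 8 → Wt ω ψ a i₁ f →
      Wt ω ψ b i₂ f → Wt ω ψ c i₃ f → (i₁ + s) % 3 = 0 → (i₂ + j) % 3 = 0 → i₃ % 3 = 0 →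
      eval w f = eval v f → eval v f ≠ 0 → eval v q = eval w q := by
    intro f i₁ i₂ i₃ hfd hfa hfb hfc h₁ h₂ h₃ hf hf0
    have hinv : f * q ∈ invariants ψ := T.mem_invariants ((hfa.mul ha).eq_self h3 h₁)
      ((hfb.mul hb).eq_self h3 h₂) ((hfc.mul hc).eq_self h3 h₃)
    have key := h _ hinv (totalDegree_mul_le hfd hd)
    rw [map_mul, map_mul, hf] at key
    exact mul_left_cancel₀ hf0 key
  set U := cyc ω (x ^ 3) (y ^ 3) (z ^ 3) with hU
  set P := cyc ω (x ^ 2 * y) (y ^ 2 * z) (z ^ 2 * x) with hP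
  have hUb : ∀ i, Wt ω ψ b (2 * i) (U i) := wt_cyc_b h3 (by rw [map_pow, S.bx])
    (by rw [map_pow, S.bY]) (by rw [map_pow, S.bz])
  have hPb : ∀ i, Wt ω ψ b (2 * i) (P i) := wt_cyc_b h3 (by rw [map_mul, map_pow, S.bx, S.bY])
    (by rw [map_mul, map_pow, S.bY, S.bz]) (by rw [map_mul, map_pow, S.bz, S.bx])
  have hUa : ∀ i, Wt ω ψ a 0 (U i) := Wt.cyc ((S.ax.pow 3).congr h3 rfl)
    ((S.ay.pow 3).congr h3 rfl) ((S.az.pow 3).congr h3 rfl)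
  have hPa : ∀ i, Wt ω ψ a 1 (P i) := Wt.cyc (((S.ax.pow 2).mul S.ay).congr h3 rfl)
    (((S.ay.pow 2).mul S.az).congr h3 rfl) (((S.az.pow 2).mul S.ax).congr h3 rfl)
  have hUc : ∀ i, Wt ω ψ c 0 (U i) := Wt.cyc ((S.cx.pow 3).congr h3 rfl)
    ((S.cy.pow 3).congr h3 rfl) ((S.cz.pow 3).congr h3 rfl)
  have hPc : ∀ i, Wt ω ψ c 0 (P i) := Wt.cyc (((S.cx.pow 2).mul S.cy).congr h3 rfl)
    (((S.cy.pow 2).mul S.cz).congr h3 rfl) (((S.cz.pow 2).mul S.cx).congr h3 rfl)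
  have hUd : ∀ i, (U i).totalDegree ≤ 3 := totalDegree_cyc_le (totalDegree_pow_le S.dx 3)
    (totalDegree_pow_le S.dy 3) (totalDegree_pow_le S.dz 3)
  have hPd : ∀ i, (P i).totalDegree ≤ 3 := totalDegree_cyc_le
    (totalDegree_mul_le (totalDegree_pow_le S.dx 2) S.dy)
    (totalDegree_mul_le (totalDegree_pow_le S.dy 2) S.dz)
    (totalDegree_mul_le (totalDegree_pow_le S.dz 2) S.dx)
  have hUw : ∀ i, eval w (U i) = eval v (U i) := fun i => by
    simp only [hU, eval_cyc, map_pow, hx, hy, hz]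
  have hPw : ∀ i, eval w (P i) = eval v (P i) := fun i => by
    simp only [hP, eval_cyc, map_pow, map_mul, hx, hy, hz]
  have hP0 : ∀ i k, i % 3 ≠ k % 3 → eval v (P i) = 0 → eval v (P k) ≠ 0 :=
    fun i k hik hi hk => hxy (cube_eq_of_cyc_eq_zero hω hy0 hz0 hik hi hk)
  have hU0 : eval v (U 1) ≠ 0 ∨ eval v (U 2) ≠ 0 := by
    by_contra! hc
    obtain ⟨h1, h2⟩ := hc
    rw [hU, eval_cyc] at h1 h2
    simp only [map_pow] at h1 h2
    have hne : 1 - ω ≠ 0 := sub_ne_zero.2 (hω.ne_one (by norm_num)).symm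
    have h0 := one_add_add_sq hω
    apply hxy
    obtain ⟨e1, e2⟩ := eq_of_cyc_eq_zero (e := ω) (X := eval v x ^ 3) (Y := eval v y ^ 3)
      (Z := eval v z ^ 3) hω h3 (by linear_combination h1) (by linear_combination h2)
    linear_combination e1 + eval v y ^ 3 * h3
  -- The multiplier needs `a`-weight 1: `P j` if nonzero, otherwise another `P` corrected by
  -- whichever of `U 1`, `U 2` is nonzero.
  have hUP : s = 2 → eval v q = eval w q := by
    intro hs2
    by_cases hj0 : eval v (P j) = 0
    · rcases hU0 with hU1 | hU2
      · exact aux (P (j + 2) * U 1) _ _ _ (totalDegree_mul_le (hPd _) (hUd _) |>.trans (by norm_num))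
          ((hPa _).mul (hUa _)) ((hPb _).mul (hUb _)) ((hPc _).mul (hUc _)) (by omega) (by omega)
          rfl (by rw [map_mul, map_mul, hPw, hUw])
          (by rw [map_mul]; exact mul_ne_zero (hP0 j (j + 2) (by omega) hj0) hU1)
      · exact aux (P (j + 1) * U 2) _ _ _ (totalDegree_mul_le (hPd _) (hUd _) |>.trans (by norm_num))
          ((hPa _).mul (hUa _)) ((hPb _).mul (hUb _)) ((hPc _).mul (hUc _)) (by omega) (by omega)
          rfl (by rw [map_mul, map_mul, hPw, hUw])
          (by rw [map_mul]; exact mul_ne_zero (hP0 j (j + 1) (by omega) hj0) hU2)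
    · exact aux (P j) _ _ _ ((hPd _).trans (by norm_num)) (hPa _) (hPb _) (hPc _) (by omega)
        (by omega) rfl (hPw _) hj0
  -- For `a`-weight 2 the multiplier is `P i * P k` with `i + k ≡ j`: the square of `P (2 * j)`, or
  -- the product of the other two if that one vanishes.
  have hPP : s = 1 → eval v q = eval w q := by
    intro hs1
    have auxP : ∀ i k, (i + k) % 3 = j % 3 → eval v (P i) ≠ 0 → eval v (P k) ≠ 0 →
        eval v q = eval w q := fun i k hik hi hk =>
      aux (P i * P k) _ _ _ (totalDegree_mul_le (hPd _) (hPd _) |>.trans (by norm_num))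
        ((hPa _).mul (hPa _)) ((hPb _).mul (hPb _)) ((hPc _).mul (hPc _)) (by omega) (by omega)
        rfl (by rw [map_mul, map_mul, hPw, hPw]) (by rw [map_mul]; exact mul_ne_zero hi hk)
    by_cases h2j : eval v (P (2 * j)) = 0
    · exact auxP (2 * j + 1) (2 * j + 2) (by omega) (hP0 _ _ (by omega) h2j)
        (hP0 _ _ (by omega) h2j)
    · exact auxP (2 * j) (2 * j) (by omega) h2j h2j
  have hUU : s = 0 → eval v q = eval w q := by
    intro hs0
    have haux1 : ∀ i, (2 * i + j) % 3 = 0 → eval v (U i) ≠ 0 → eval v q = eval w q :=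
      fun i hi hne => aux (U i) _ _ _ ((hUd _).trans (by norm_num)) (hUa _) (hUb _) (hUc _)
        (by omega) (by omega) rfl (hUw _) hne
    have haux2 : ∀ i, (2 * (2 * i) + j) % 3 = 0 → eval v (U i) ≠ 0 → eval v q = eval w q :=
      fun i hi hne => aux (U i ^ 2) _ _ _ ((totalDegree_pow_le (hUd _) 2).trans (by norm_num))
        ((hUa _).pow 2) ((hUb _).pow 2) ((hUc _).pow 2)
        (by omega) (by omega) rfl (by rw [map_pow, map_pow, hUw])
        (by rw [map_pow]; exact pow_ne_zero 2 hne)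
    obtain rfl | rfl | rfl : j = 0 ∨ j = 1 ∨ j = 2 := by omega
    · refine aux 1 0 0 0 (by simp) ?_ ?_ ?_ (by omega) rfl rfl (by simp) (by simp) <;> simp [Wt]
    · rcases hU0 with hU1 | hU2
      · exact haux1 1 rfl hU1
      · exact haux2 2 rfl hU2
    · rcases hU0 with hU1 | hU2
      · exact haux2 1 rfl hU1
      · exact haux1 2 rfl hU2
  obtain h | h | h : s = 0 ∨ s = 1 ∨ s = 2 := by omega
  exacts [hUU h, hPP h, hUP h]

/-- For forms on which `c` acts nontrivially, a polynomial `D` in the cubes isolates `v` from its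
`b`-translates. It costs degree 6, leaving degree 2 for a monomial matching the weights of `q`. -/
theorem eq_of_generic (T : HeisTriple a b c) (hω : IsPrimitiveRoot ω 3)
    (S : Coords ω ψ a b c x y z) (h : Agree ψ 9 v w) (hx : eval w x = eval v x)
    (hy : eval w y = eval v y) (hz : eval w z = eval v z) (hx0 : eval v x ≠ 0)
    (hy0 : eval v y ≠ 0) (hz0 : eval v z ≠ 0) (hxy : eval v x ^ 3 ≠ eval v y ^ 3) : v = w := by
  have h3 := hω.pow_eq_one
  refine eq_of_forall_wt_b (ψ := ψ) T hω (fun k hk hk0 q hd s hs hc ha => ?_)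
    fun s hs j hj q hd hc ha hb =>
      eq_of_generic_of_wt_zero T hω S h hx hy hz hy0 hz0 hxy hs hj hd hc ha hb
  -- Each of the two `b`-translates of `D` has a factor vanishing at `v` and `w`, whereas `D` itself
  -- takes the value `-(x³ - y³)² ≠ 0` there.
  set D := (x ^ 3 - C (eval v y ^ 3)) * (y ^ 3 - C (eval v x ^ 3)) with hD
  have hDa : Wt ω ψ a 0 D := ((((S.ax.pow 3).congr h3 (j := 0) rfl).sub_C _).mul
    (((S.ay.pow 3).congr h3 (j := 0) rfl).sub_C _)).congr h3 rfl
  have hDc : Wt ω ψ c 0 D := ((((S.cx.pow 3).congr h3 (j := 0) rfl).sub_C _).mul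
    (((S.cy.pow 3).congr h3 (j := 0) rfl).sub_C _)).congr h3 rfl
  have hDd : D.totalDegree ≤ 6 := (totalDegree_mul_le
    (totalDegree_sub_C_le (totalDegree_pow_le S.dx 3) _)
    (totalDegree_sub_C_le (totalDegree_pow_le S.dy 3) _)).trans (by norm_num)
  have hDv : eval v D ≠ 0 := by
    simp only [hD, map_mul, map_sub, map_pow, eval_C]
    exact mul_ne_zero (sub_ne_zero.2 hxy) (sub_ne_zero.2 hxy.symm)
  have hDw : eval w D = eval v D := by
    simp only [hD, map_mul, map_sub, map_pow, eval_C, hx, hy]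
  have hD1 : polyAct ψ b D = (y ^ 3 - C (eval v y ^ 3)) * (z ^ 3 - C (eval v x ^ 3)) := by
    simp only [hD, map_mul, map_sub, map_pow, S.bx, S.bY, algHom_C, algebraMap_eq]
  have hD2 : polyAct ψ b (polyAct ψ b D) =
      (z ^ 3 - C (eval v y ^ 3)) * (x ^ 3 - C (eval v x ^ 3)) := by
    simp only [hD1, map_mul, map_sub, map_pow, S.bY, S.bz, algHom_C, algebraMap_eq]
  have hDv1 : eval v (polyAct ψ b D) = 0 := by
    rw [hD1, map_mul, map_sub, map_pow, eval_C, sub_self, zero_mul]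
  have hDw1 : eval w (polyAct ψ b D) = 0 := by
    rw [hD1, map_mul, map_sub, map_pow, eval_C, hy, sub_self, zero_mul]
  have hDv2 : eval v (polyAct ψ b (polyAct ψ b D)) = 0 := by
    simp only [hD2, map_mul, map_sub, map_pow, eval_C, sub_self, mul_zero]
  have hDw2 : eval w (polyAct ψ b (polyAct ψ b D)) = 0 := by
    simp only [hD2, map_mul, map_sub, map_pow, eval_C, hx, sub_self, mul_zero]
  have aux : ∀ (m : MvPolynomial (Fin n) K) (i₁ i₂ : ℕ), m.totalDegree ≤ 2 → Wt ω ψ a i₁ m →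
      Wt ω ψ c i₂ m → (i₁ + s) % 3 = 0 → (i₂ + k) % 3 = 0 → eval w m = eval v m →
      eval v m ≠ 0 → eval v q = eval w q := by
    intro m i₁ i₂ hmd hma hmc h₁ h₂ hm hm0
    have key := T.eval_sum_eq h3 h ((hma.mul hDa).mul ha) ((hmc.mul hDc).mul hc) (by omega)
      (by omega) (totalDegree_mul_le (totalDegree_mul_le hmd hDd) hd)
    simp only [map_mul, hDv1, hDw1, hDv2, hDw2, mul_zero, zero_mul, add_zero, hm, hDw] at key
    exact mul_left_cancel₀ (mul_ne_zero hm0 hDv) key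
  -- The monomial is `l` for `k = 2` and `l²` for `k = 1`, so that total `c`-weight is 3.
  have aux1 : ∀ (l : MvPolynomial (Fin n) K) (i : ℕ), l.totalDegree ≤ 1 → Wt ω ψ a i l →
      Wt ω ψ c 1 l → (k = 2 → (i + s) % 3 = 0) → (k = 1 → (2 * i + s) % 3 = 0) →
      eval w l = eval v l → eval v l ≠ 0 → eval v q = eval w q := by
    intro l i hld hla hlc h₂ h₁ hl hl0
    obtain rfl | rfl : k = 1 ∨ k = 2 := by omega
    · exact aux (l ^ 2) _ _ (totalDegree_pow_le hld 2) (hla.pow 2) (hlc.pow 2) (h₁ rfl) rfl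
        (by rw [map_pow, map_pow, hl]) (by rw [map_pow]; exact pow_ne_zero 2 hl0)
    · exact aux l _ _ (hld.trans one_le_two) hla hlc (h₂ rfl) rfl hl hl0
  have hk' : k = 1 ∨ k = 2 := by omega
  obtain h | h | h : s = 0 ∨ (s = 1 ∧ k = 1 ∨ s = 2 ∧ k = 2) ∨ (s = 1 ∧ k = 2 ∨ s = 2 ∧ k = 1) := by
    omega
  · exact aux1 x 0 S.dx S.ax S.cx (by omega) (by omega) hx hx0
  · exact aux1 y 1 S.dy S.ay S.cy (by omega) (by omega) hy hy0
  · exact aux1 z 2 S.dz S.az S.cz (by omega) (by omega) hz hz0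

end Generic

/-! ### Points with a nonzero coordinate in a three-dimensional constituent -/

section Faithful

variable {K : Type*} [Field K] {G : Type*} [Group G] {n : ℕ}
variable {ω : K} {ψ : G →* GL (Fin n) K} {a b c : G} {v w : Fin n → K}
variable {x y z : MvPolynomial (Fin n) K}

theorem SameOrbit.of_move (g : G) (h : SameOrbit ψ (move ψ g v) (move ψ g w)) :
    SameOrbit ψ v w := (h.of_move_left g).of_move_right g

theorem SameOrbit.of_eq (h : v = w) : SameOrbit ψ v w := h ▸ SameOrbit.refl ψ v

theorem Agree.move {d : ℕ} (h : Agree ψ d v w) (g : G) :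
    Agree ψ d (move ψ g v) (move ψ g w) := (h.move_left g).move_right g

theorem sameOrbit_of_coords_eq_of_ne_zero (T : HeisTriple a b c) (hω : IsPrimitiveRoot ω 3)
    (S : Coords ω ψ a b c x y z) (h : Agree ψ 9 v w) (hx : eval w x = eval v x)
    (hy : eval w y = eval v y) (hz : eval w z = eval v z) (hx0 : eval v x ≠ 0) :
    SameOrbit ψ v w := by
  have mx : ∀ u, eval (move ψ b u) x = eval u y := fun u => by rw [eval_move, S.bx]
  have my : ∀ u, eval (move ψ b u) y = eval u z := fun u => by rw [eval_move, S.bY]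
  have mz : ∀ u, eval (move ψ b u) z = eval u x := fun u => by rw [eval_move, S.bz]
  by_cases hy0 : eval v y = 0
  · by_cases hz0 : eval v z = 0
    · exact sameOrbit_of_two_zero T hω S h hx hx0 hy0 hz0 (hy.trans hy0) (hz.trans hz0)
    · refine SameOrbit.of_move b (SameOrbit.of_move b (SameOrbit.of_eq ?_))
      refine eq_of_one_zero T hω S ((h.move b).move b) ?_ ?_ ?_ ?_ ?_ ?_ <;>
        simp only [mx, my, mz]
      exacts [hz, hx, hz0, hx0, hy0, hy.trans hy0]
  · by_cases hz0 : eval v z = 0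
    · exact .of_eq (eq_of_one_zero T hω S h hx hy hx0 hy0 hz0 (hz.trans hz0))
    · by_cases hxy : eval v x ^ 3 = eval v y ^ 3
      · by_cases hyz : eval v y ^ 3 = eval v z ^ 3
        · exact sameOrbit_of_cubes_eq T hω S h hx hy hz hx0 hxy (hxy.trans hyz)
        · refine SameOrbit.of_move b (SameOrbit.of_eq ?_)
          refine eq_of_generic T hω S (h.move b) ?_ ?_ ?_ ?_ ?_ ?_ ?_ <;> simp only [mx, my, mz]
          exacts [hy, hz, hx, hy0, hz0, hx0, hyz]
      · exact .of_eq (eq_of_generic T hω S h hx hy hz hx0 hy0 hz0 hxy)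

theorem sameOrbit_of_coords_eq (T : HeisTriple a b c) (hω : IsPrimitiveRoot ω 3)
    (S : Coords ω ψ a b c x y z) (h : Agree ψ 9 v w) (hx : eval w x = eval v x)
    (hy : eval w y = eval v y) (hz : eval w z = eval v z)
    (h0 : eval v x ≠ 0 ∨ eval v y ≠ 0 ∨ eval v z ≠ 0) : SameOrbit ψ v w := by
  have mx : ∀ u, eval (move ψ b u) x = eval u y := fun u => by rw [eval_move, S.bx]
  have my : ∀ u, eval (move ψ b u) y = eval u z := fun u => by rw [eval_move, S.bY]
  have mz : ∀ u, eval (move ψ b u) z = eval u x := fun u => by rw [eval_move, S.bz]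
  rcases h0 with h0 | h0 | h0
  · exact sameOrbit_of_coords_eq_of_ne_zero T hω S h hx hy hz h0
  · refine SameOrbit.of_move b ?_
    refine sameOrbit_of_coords_eq_of_ne_zero T hω S (h.move b) ?_ ?_ ?_ ?_ <;>
      simpa only [mx, my, mz]
  · refine SameOrbit.of_move b (SameOrbit.of_move b ?_)
    refine sameOrbit_of_coords_eq_of_ne_zero T hω S ((h.move b).move b) ?_ ?_ ?_ ?_ <;>
      simpa only [mx, my, mz]

/-- The elementary symmetric functions determine the triple up to permutation. An odd permutation
changes the cyclic sum of `X²Y` by the Vandermonde product up to sign, so it is allowed only if two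
entries coincide, and then it is also a cyclic shift. -/
theorem cyclic_shift_of_symm_eq {X Y Z X' Y' Z' : K} (h1 : X' + Y' + Z' = X + Y + Z)
    (h2 : X' * Y' + Y' * Z' + Z' * X' = X * Y + Y * Z + Z * X) (h3 : X' * Y' * Z' = X * Y * Z)
    (h4 : X' ^ 2 * Y' + Y' ^ 2 * Z' + Z' ^ 2 * X' = X ^ 2 * Y + Y ^ 2 * Z + Z ^ 2 * X) :
    (X' = X ∧ Y' = Y ∧ Z' = Z) ∨ (X' = Y ∧ Y' = Z ∧ Z' = X) ∨ (X' = Z ∧ Y' = X ∧ Z' = Y) := by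
  have aux : ∀ X Y Z : K, X' + Y' + Z' = X + Y + Z →
      X' * Y' + Y' * Z' + Z' * X' = X * Y + Y * Z + Z * X →
      X' ^ 2 * Y' + Y' ^ 2 * Z' + Z' ^ 2 * X' = X ^ 2 * Y + Y ^ 2 * Z + Z ^ 2 * X → X' = X →
      (X' = X ∧ Y' = Y ∧ Z' = Z) ∨ (X' = Y ∧ Y' = Z ∧ Z' = X) ∨
        (X' = Z ∧ Y' = X ∧ Z' = Y) := by
    rintro X Y Z h1 h2 h4 rfl
    have hY : (Y' - Y) * (Y' - Z) = 0 := by linear_combination (Y' + X') * h1 - h2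
    rcases mul_eq_zero.1 hY with hY | hY
    · have hY := sub_eq_zero.1 hY
      exact .inl ⟨rfl, hY, by linear_combination h1 - hY⟩
    · obtain rfl := sub_eq_zero.1 hY
      obtain rfl : Z' = Y := by linear_combination h1
      have : (X' - Z') * (Z' - Y') * (Y' - X') = 0 := by linear_combination h4
      rcases mul_eq_zero.1 this with h | h
      · rcases mul_eq_zero.1 h with h | h
        · obtain rfl := sub_eq_zero.1 h
          exact .inr (.inl ⟨rfl, rfl, rfl⟩)
        · obtain rfl := sub_eq_zero.1 h
          exact .inl ⟨rfl, rfl, rfl⟩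
      · obtain rfl := sub_eq_zero.1 h
        exact .inr (.inr ⟨rfl, rfl, rfl⟩)
  have hX : (X' - X) * ((X' - Y) * (X' - Z)) = 0 := by
    linear_combination X' ^ 2 * h1 - X' * h2 + h3
  rcases mul_eq_zero.1 hX with h | h
  · exact aux X Y Z h1 h2 h4 (sub_eq_zero.1 h)
  rcases mul_eq_zero.1 h with h | h
  · have := aux Y Z X (by linear_combination h1) (by linear_combination h2)
      (by linear_combination h4) (sub_eq_zero.1 h)
    tauto
  · have := aux Z X Y (by linear_combination h1) (by linear_combination h2)
      (by linear_combination h4) (sub_eq_zero.1 h)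
    tauto

/-- Diagonal scalings by cube roots of unity with product 1 are exactly those by `aᵖc^q`. Equality
of the products `xyz` forces product 1 if no coordinate vanishes; the exponent at a zero coordinate
is free and can be adjusted. -/
theorem exists_pow_of_cubes_eq (hω : IsPrimitiveRoot ω 3) {x y z x' y' z' : K}
    (hx : x ^ 3 = x' ^ 3) (hy : y ^ 3 = y' ^ 3) (hz : z ^ 3 = z' ^ 3)
    (h : x' * y' * z' = x * y * z) :
    ∃ p q : ℕ, x' = ω ^ q * x ∧ y' = ω ^ (p + q) * y ∧ z' = ω ^ (2 * p + q) * z := by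
  have h3 := hω.pow_eq_one
  suffices hs : ∃ i j k : ℕ, (i + j + k) % 3 = 0 ∧ x' = ω ^ i * x ∧ y' = ω ^ j * y ∧
      z' = ω ^ k * z by
    obtain ⟨i, j, k, hs, rfl, rfl, rfl⟩ := hs
    refine ⟨j + 2 * i, i, rfl, ?_, ?_⟩
    · rw [pow_eq_pow_of_modEq h3 (show (j + 2 * i + i) % 3 = j % 3 by omega)]
    · rw [pow_eq_pow_of_modEq h3 (show (2 * (j + 2 * i) + i) % 3 = k % 3 by omega)]
  obtain ⟨i, hi, rfl⟩ := exists_eq_pow_mul hω hx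
  obtain ⟨j, hj, rfl⟩ := exists_eq_pow_mul hω hy
  obtain ⟨k, hk, rfl⟩ := exists_eq_pow_mul hω hz
  by_cases hx0 : x = 0
  · exact ⟨2 * (j + k), j, k, by omega, by simp [hx0], rfl, rfl⟩
  by_cases hy0 : y = 0
  · exact ⟨i, 2 * (i + k), k, by omega, rfl, by simp [hy0], rfl⟩
  by_cases hz0 : z = 0
  · exact ⟨i, j, 2 * (i + j), by omega, rfl, rfl, by simp [hz0]⟩
  refine ⟨i, j, k, ?_, rfl, rfl, rfl⟩
  have h1 : ω ^ (i + j + k) = 1 := by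
    refine mul_right_cancel₀ (mul_ne_zero (mul_ne_zero hx0 hy0) hz0) ?_
    rw [pow_add, pow_add]
    linear_combination h
  exact Nat.mod_eq_zero_of_dvd (hω.dvd_of_pow_eq_one _ h1)

/-- Points whose cubes of coordinates agree up to a cyclic shift, and whose products of coordinates
agree, have the same coordinates after moving one of them by a group element. -/
theorem exists_move_of_cubes (hω : IsPrimitiveRoot ω 3)
    (S : Coords ω ψ a b c x y z)
    (hc : (eval w x ^ 3 = eval v x ^ 3 ∧ eval w y ^ 3 = eval v y ^ 3 ∧
        eval w z ^ 3 = eval v z ^ 3) ∨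
      (eval w x ^ 3 = eval v y ^ 3 ∧ eval w y ^ 3 = eval v z ^ 3 ∧
        eval w z ^ 3 = eval v x ^ 3) ∨
      (eval w x ^ 3 = eval v z ^ 3 ∧ eval w y ^ 3 = eval v x ^ 3 ∧
        eval w z ^ 3 = eval v y ^ 3))
    (hm : eval w x * eval w y * eval w z = eval v x * eval v y * eval v z) :
    ∃ g, eval w x = eval (move ψ g v) x ∧ eval w y = eval (move ψ g v) y ∧
      eval w z = eval (move ψ g v) z := by
  have mx : ∀ u, eval (move ψ b u) x = eval u y := fun u => by rw [eval_move, S.bx]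
  have my : ∀ u, eval (move ψ b u) y = eval u z := fun u => by rw [eval_move, S.bY]
  have mz : ∀ u, eval (move ψ b u) z = eval u x := fun u => by rw [eval_move, S.bz]
  have mm : ∀ g h : G, ∀ u, move ψ g (move ψ h u) = move ψ (h * g) u := fun g h u => by
    simp only [move, Matrix.mulVec_mulVec, ← Units.val_mul, ← map_mul, mul_inv_rev]
  have aux : ∀ u, eval w x ^ 3 = eval u x ^ 3 → eval w y ^ 3 = eval u y ^ 3 →
      eval w z ^ 3 = eval u z ^ 3 →
      eval w x * eval w y * eval w z = eval u x * eval u y * eval u z →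
      ∃ g, eval w x = eval (move ψ g u) x ∧ eval w y = eval (move ψ g u) y ∧
      eval w z = eval (move ψ g u) z := by
    intro u h1 h2 h3 h
    obtain ⟨p, q, e1, e2, e3⟩ := exists_pow_of_cubes_eq hω h1.symm h2.symm h3.symm h
    refine ⟨a ^ p * c ^ q, ?_, ?_, ?_⟩
    · rw [((S.ax.elem_pow p).elem_mul (S.cx.elem_pow q)).eval_move u, e1, mul_zero, zero_add,
        mul_one]
    · rw [((S.ay.elem_pow p).elem_mul (S.cy.elem_pow q)).eval_move u, e2, mul_one, mul_one]
    · rw [((S.az.elem_pow p).elem_mul (S.cz.elem_pow q)).eval_move u, e3, mul_one, mul_comm p]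
  rcases hc with ⟨h1, h2, h3⟩ | ⟨h1, h2, h3⟩ | ⟨h1, h2, h3⟩
  · exact aux v h1 h2 h3 hm
  · obtain ⟨g, hg⟩ := aux (move ψ b v) (by rwa [mx]) (by rwa [my]) (by rwa [mz])
      (by rw [mx, my, mz, hm]; ring)
    exact ⟨b * g, by rwa [← mm]⟩
  · obtain ⟨g, hg⟩ := aux (move ψ b (move ψ b v)) (by rwa [mx, my]) (by rwa [my, mz])
      (by rwa [mz, mx]) (by rw [mx, my, mz, mx, my, mz, hm]; ring)
    exact ⟨b * (b * g), by rwa [← mm, ← mm]⟩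

theorem Coords.mul_mem_invariants (T : HeisTriple a b c) (hω : ω ^ 3 = 1)
    (S : Coords ω ψ a b c x y z) : x * y * z ∈ invariants ψ :=
  T.mem_invariants (((S.ax.mul S.ay).mul S.az).eq_self hω rfl)
    (by rw [map_mul, map_mul, S.bx, S.bY, S.bz]; ring)
    (((S.cx.mul S.cy).mul S.cz).eq_self hω rfl)

/-- Cyclically symmetric polynomials in the cubes of the coordinates are invariant. -/
theorem Coords.cubes_mem_invariants (T : HeisTriple a b c) (hω : ω ^ 3 = 1)
    (S : Coords ω ψ a b c x y z) (p : MvPolynomial (Fin 3) K)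
    (hp : aeval ![y ^ 3, z ^ 3, x ^ 3] p = aeval ![x ^ 3, y ^ 3, z ^ 3] p) :
    aeval ![x ^ 3, y ^ 3, z ^ 3] p ∈ invariants ψ := by
  have key : ∀ g, polyAct ψ g (aeval ![x ^ 3, y ^ 3, z ^ 3] p) =
      aeval ![polyAct ψ g x ^ 3, polyAct ψ g y ^ 3, polyAct ψ g z ^ 3] p := by
    intro g
    rw [← AlgHom.comp_apply, comp_aeval]
    congr 2
    ext1 i
    fin_cases i <;> simp
  refine T.mem_invariants ?_ ?_ ?_
  · rw [key, ← map_pow, ← map_pow, ← map_pow, (S.ax.pow 3).eq_self hω rfl,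
      (S.ay.pow 3).eq_self hω rfl, (S.az.pow 3).eq_self hω rfl]
  · rw [key, S.bx, S.bY, S.bz, hp]
  · rw [key, ← map_pow, ← map_pow, ← map_pow, (S.cx.pow 3).eq_self hω rfl,
      (S.cy.pow 3).eq_self hω rfl, (S.cz.pow 3).eq_self hω rfl]

theorem Coords.e1_mem (T : HeisTriple a b c) (hω : ω ^ 3 = 1)
    (S : Coords ω ψ a b c x y z) : x ^ 3 + y ^ 3 + z ^ 3 ∈ invariants ψ := by
  have h := S.cubes_mem_invariants T hω (X 0 + X 1 + X 2) (by simp; ring)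
  simpa using h

theorem Coords.e2_mem (T : HeisTriple a b c) (hω : ω ^ 3 = 1)
    (S : Coords ω ψ a b c x y z) :
    x ^ 3 * y ^ 3 + y ^ 3 * z ^ 3 + z ^ 3 * x ^ 3 ∈ invariants ψ := by
  have h := S.cubes_mem_invariants T hω (X 0 * X 1 + X 1 * X 2 + X 2 * X 0) (by simp; ring)
  simpa using h

theorem Coords.cyclic_mem (T : HeisTriple a b c) (hω : ω ^ 3 = 1)
    (S : Coords ω ψ a b c x y z) :
    (x ^ 3) ^ 2 * y ^ 3 + (y ^ 3) ^ 2 * z ^ 3 + (z ^ 3) ^ 2 * x ^ 3 ∈ invariants ψ := by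
  have h := S.cubes_mem_invariants T hω (X 0 ^ 2 * X 1 + X 1 ^ 2 * X 2 + X 2 ^ 2 * X 0)
    (by simp; ring)
  simpa using h

theorem Coords.agree_mul (T : HeisTriple a b c) (hω : ω ^ 3 = 1)
    (S : Coords ω ψ a b c x y z) {d : ℕ} (hd : 3 ≤ d) (h : Agree ψ d v w) :
    eval w x * eval w y * eval w z = eval v x * eval v y * eval v z := by
  have := h _ (S.mul_mem_invariants T hω)
    ((totalDegree_mul_le (totalDegree_mul_le S.dx S.dy) S.dz).trans hd)
  simpa only [map_mul] using this.symm

theorem Coords.agree_e1 (T : HeisTriple a b c) (hω : ω ^ 3 = 1)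
    (S : Coords ω ψ a b c x y z) {d : ℕ} (hd : 3 ≤ d) (h : Agree ψ d v w) :
    eval w x ^ 3 + eval w y ^ 3 + eval w z ^ 3 = eval v x ^ 3 + eval v y ^ 3 + eval v z ^ 3 := by
  have := h _ (S.e1_mem T hω) ((totalDegree_add_le (totalDegree_add_le
    (totalDegree_pow_le S.dx 3) (totalDegree_pow_le S.dy 3)) (totalDegree_pow_le S.dz 3)).trans hd)
  simpa only [map_add, map_pow] using this.symm

theorem Coords.agree_e2 (T : HeisTriple a b c) (hω : ω ^ 3 = 1)
    (S : Coords ω ψ a b c x y z) {d : ℕ} (hd : 6 ≤ d) (h : Agree ψ d v w) :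
    eval w x ^ 3 * eval w y ^ 3 + eval w y ^ 3 * eval w z ^ 3 + eval w z ^ 3 * eval w x ^ 3 =
      eval v x ^ 3 * eval v y ^ 3 + eval v y ^ 3 * eval v z ^ 3 + eval v z ^ 3 * eval v x ^ 3 := by
  have dx := totalDegree_pow_le S.dx 3
  have dy := totalDegree_pow_le S.dy 3
  have dz := totalDegree_pow_le S.dz 3
  have := h _ (S.e2_mem T hω) ((totalDegree_add_le (totalDegree_add_le
    (totalDegree_mul_le dx dy) (totalDegree_mul_le dy dz)) (totalDegree_mul_le dz dx)).trans hd)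
  simpa only [map_add, map_mul, map_pow] using this.symm

theorem Coords.agree_cyclic (T : HeisTriple a b c) (hω : ω ^ 3 = 1)
    (S : Coords ω ψ a b c x y z) (h : Agree ψ 9 v w) :
    (eval w x ^ 3) ^ 2 * eval w y ^ 3 + (eval w y ^ 3) ^ 2 * eval w z ^ 3 +
        (eval w z ^ 3) ^ 2 * eval w x ^ 3 =
      (eval v x ^ 3) ^ 2 * eval v y ^ 3 + (eval v y ^ 3) ^ 2 * eval v z ^ 3 +
        (eval v z ^ 3) ^ 2 * eval v x ^ 3 := by
  have dx := totalDegree_pow_le S.dx 3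
  have dy := totalDegree_pow_le S.dy 3
  have dz := totalDegree_pow_le S.dz 3
  have := h _ (S.cyclic_mem T hω) (totalDegree_add_le (totalDegree_add_le
    (totalDegree_mul_le (totalDegree_pow_le dx 2) dy)
    (totalDegree_mul_le (totalDegree_pow_le dy 2) dz))
    (totalDegree_mul_le (totalDegree_pow_le dz 2) dx))
  simpa only [map_add, map_mul, map_pow] using this.symm

theorem sameOrbit_of_coords_ne_zero (T : HeisTriple a b c) (hω : IsPrimitiveRoot ω 3)
    (S : Coords ω ψ a b c x y z) (h : Agree ψ 9 v w)
    (h0 : eval w x ≠ 0 ∨ eval w y ≠ 0 ∨ eval w z ≠ 0) : SameOrbit ψ v w := by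
  have h3 := hω.pow_eq_one
  have hm := S.agree_mul T h3 (by norm_num) h
  obtain ⟨g, hx, hy, hz⟩ := exists_move_of_cubes (ψ := ψ) (v := v) (w := w) hω S
    (cyclic_shift_of_symm_eq (S.agree_e1 T h3 (by norm_num) h) (S.agree_e2 T h3 (by norm_num) h)
      (by rw [← mul_pow, ← mul_pow, hm, mul_pow, mul_pow]) (S.agree_cyclic T h3 h)) hm
  refine SameOrbit.of_move_left g ?_
  rw [hx, hy, hz] at h0
  exact sameOrbit_of_coords_eq T hω S (h.move_left g) hx hy hz h0

/-- If a polynomial of degree at most one on which `c` acts by `ω` does not vanish at `w`, then the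
invariants of degree at most nine separate `w` from the other orbits. -/
theorem sameOrbit_of_wt_c_ne_zero (T : HeisTriple a b c) (hω : IsPrimitiveRoot ω 3)
    (h : Agree ψ 9 v w) {l : MvPolynomial (Fin n) K} (hd : l.totalDegree ≤ 1)
    (hc : Wt ω ψ c 1 l) (hl : eval w l ≠ 0) : SameOrbit ψ v w := by
  have h3 := hω.pow_eq_one
  by_contra hne
  refine hl ?_
  have hle : linearForms K n ⊓ wtSubmodule ω ψ c 1 ≤
      LinearMap.ker (aeval w : MvPolynomial (Fin n) K →ₐ[K] K).toLinearMap := by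
    refine linearForms_inf_le_of_wt_a T hω fun s hs f hfd hfc hfa => ?_
    rw [LinearMap.mem_ker]
    change aeval w f = 0
    rw [aeval_eq_eval]
    by_contra hf0
    have hbc := T.wt_c hfc
    have hba := T.wt_a hfa hfc
    have hbd := totalDegree_polyAct_le ψ b hfd
    have hb3 := T.b_b_b (ψ := ψ) f
    -- According to its `a`-weight, `f` serves as the coordinate `x`, `y` or `z` of a copy of the
    -- representation.
    obtain rfl | rfl | rfl : s = 0 ∨ s = 1 ∨ s = 2 := by omega
    · exact hne (sameOrbit_of_coords_ne_zero T hω (T.coords hfd hfa hfc) h (.inl hf0))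
    · refine hne (sameOrbit_of_coords_ne_zero T hω (T.coords (totalDegree_polyAct_le ψ b hbd)
        ((T.wt_a hba hbc).congr h3 rfl) (T.wt_c hbc)) h (.inr (.inl ?_)))
      rwa [hb3]
    · refine hne (sameOrbit_of_coords_ne_zero T hω (T.coords hbd
        (hba.congr h3 rfl) hbc) h (.inr (.inr ?_)))
      rwa [hb3]
  exact hle ⟨mem_linearForms.2 hd, hc⟩

end Faithful

/-! ### Points seen only by characters of the abelian quotient -/

section Abelian

variable {K : Type*} [Field K] {G : Type*} [Group G] {n : ℕ}
variable {ω : K} {ψ : G →* GL (Fin n) K} {a b c : G} {v w : Fin n → K}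

/-- Replacing `ω` by `ω²` exchanges the two nontrivial central characters. -/
theorem sameOrbit_of_wt_c_eq_two (T : HeisTriple a b c) (hω : IsPrimitiveRoot ω 3)
    (h : Agree ψ 9 v w) {l : MvPolynomial (Fin n) K} (hd : l.totalDegree ≤ 1)
    (hc : Wt ω ψ c 2 l) (hl : eval w l ≠ 0) : SameOrbit ψ v w :=
  sameOrbit_of_wt_c_ne_zero T (hω.pow_of_coprime 2 (by norm_num)) h hd
    (by rw [Wt, ← pow_mul, mul_one]; exact hc) hl

/-- By the previous results, forms with nontrivial `c`-weight vanish at both points when the orbits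
differ, so the difference shows in a character of `C₃ × C₃`. -/
theorem exists_character_ne (T : HeisTriple a b c) (hω : IsPrimitiveRoot ω 3)
    (h : Agree ψ 9 v w) (hne : ¬ SameOrbit ψ v w) :
    ∃ s < 3, ∃ j < 3, ∃ f : MvPolynomial (Fin n) K, f.totalDegree ≤ 1 ∧ Wt ω ψ c 0 f ∧
      Wt ω ψ a s f ∧ Wt ω ψ b j f ∧ eval v f ≠ eval w f := by
  by_contra! hcon
  refine hne (SameOrbit.of_eq ?_)
  refine eq_of_forall_wt_b (ψ := ψ) T hω (fun k hk hk0 f hd s _ hc _ => ?_) hcon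
  have hne' : ¬ SameOrbit ψ w v := fun hs => hne hs.symm
  obtain rfl | rfl : k = 1 ∨ k = 2 := by omega
  · have h1 : eval v f = 0 := by
      by_contra h0
      exact hne' (sameOrbit_of_wt_c_ne_zero T hω h.symm hd hc h0)
    have h2 : eval w f = 0 := by
      by_contra h0
      exact hne (sameOrbit_of_wt_c_ne_zero T hω h hd hc h0)
    rw [h1, h2]
  · have h1 : eval v f = 0 := by
      by_contra h0
      exact hne' (sameOrbit_of_wt_c_eq_two T hω h.symm hd hc h0)
    have h2 : eval w f = 0 := by
      by_contra h0
      exact hne (sameOrbit_of_wt_c_eq_two T hω h hd hc h0)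
    rw [h1, h2]

theorem Agree.eval_eq (T : HeisTriple a b c) (hω : ω ^ 3 = 1) (h : Agree ψ 9 v w)
    {f : MvPolynomial (Fin n) K} {i j k : ℕ} (hd : f.totalDegree ≤ 9) (hc : Wt ω ψ c k f)
    (ha : Wt ω ψ a i f) (hb : Wt ω ψ b j f) (hk : k % 3 = 0) (hi : i % 3 = 0) (hj : j % 3 = 0) :
    eval v f = eval w f :=
  h f (T.mem_invariants (ha.eq_self hω hi) (hb.eq_self hω hj) (hc.eq_self hω hk)) hd

theorem exists_mul_add_mul_mod_three : ∀ s < 3, ∀ j < 3, s ≠ 0 ∨ j ≠ 0 → ∀ t < 3,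
    ∃ p < 3, ∃ q < 3, (p * s + q * j) % 3 = t := by decide

/-- The expression `s * j' + 2 * (s' * j)` is the determinant of the characters `(s, j)`, `(s', j')`
modulo 3; here and below it decides whether they are dependent. -/
theorem exists_multiple_mod_three : ∀ s < 3, ∀ j < 3, s ≠ 0 ∨ j ≠ 0 → ∀ s' < 3, ∀ j' < 3,
    (s * j' + 2 * (s' * j)) % 3 = 0 → ∃ r < 3, (s' + r * s) % 3 = 0 ∧ (j' + r * j) % 3 = 0 := by
  intro s hs j hj
  interval_cases s <;> interval_cases j <;> decide

theorem exists_solution_mod_three : ∀ s < 3, ∀ j < 3, ∀ s' < 3, ∀ j' < 3,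
    (s * j' + 2 * (s' * j)) % 3 ≠ 0 → ∀ t < 3,
      ∃ p < 3, ∃ q < 3, (p * s + q * j) % 3 = 0 ∧ (p * s' + q * j') % 3 = t := by
  intro s hs j hj
  interval_cases s <;> interval_cases j <;> decide

theorem exists_combination_mod_three : ∀ s < 3, ∀ j < 3, ∀ s' < 3, ∀ j' < 3,
    (s * j' + 2 * (s' * j)) % 3 ≠ 0 → ∀ s'' < 3, ∀ j'' < 3,
      ∃ p < 3, ∃ q < 3, (s'' + p * s + q * s') % 3 = 0 ∧ (j'' + p * j + q * j') % 3 = 0 := by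
  intro s hs j hj s' hs' j' hj'
  interval_cases s <;> interval_cases j <;> interval_cases s' <;> interval_cases j' <;> decide

/-- The invariants of degree at most nine separate the orbits. -/
theorem sameOrbit_of_agree (T : HeisTriple a b c) (hω : IsPrimitiveRoot ω 3)
    (h : Agree ψ 9 v w) : SameOrbit ψ v w := by
  have h3 := hω.pow_eq_one
  by_contra hne
  obtain ⟨s, hs, j, hj, l, hld, hlc, hla, hlb, hl⟩ := exists_character_ne T hω h hne
  have hsj : s ≠ 0 ∨ j ≠ 0 := by
    by_contra! h0
    exact hl (h.eval_eq T h3 (by omega) hlc hla hlb rfl (by omega) (by omega))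
  have hl3 := h.eval_eq T h3 ((totalDegree_pow_le hld 3).trans (by norm_num)) (hlc.pow 3)
    (hla.pow 3) (hlb.pow 3) rfl (by omega) (by omega)
  rw [map_pow, map_pow] at hl3
  obtain ⟨t, ht, htl⟩ := exists_eq_pow_mul hω hl3
  have hlw : eval w l ≠ 0 := fun h0 => hl (by
    rw [h0] at hl3 ⊢
    exact pow_eq_zero_iff (n := 3) (by norm_num) |>.1 (by rw [hl3]; norm_num))
  -- The character of `l` is nontrivial, so some `aᵖb^q` scales it by the required root of unity and
  -- makes `l` agree.
  obtain ⟨p, -, q, -, hpq⟩ := exists_mul_add_mul_mod_three s hs j hj hsj t ht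
  have hlu := ((hla.elem_pow p).elem_mul (hlb.elem_pow q)).eval_move v
  rw [pow_eq_pow_of_modEq h3 (show (p * s + q * j) % 3 = t % 3 by omega), ← htl] at hlu
  replace h := h.move_left (a ^ p * b ^ q)
  replace hne := fun hs => hne (SameOrbit.of_move_left (ψ := ψ) (a ^ p * b ^ q) hs)
  set u := move ψ (a ^ p * b ^ q) v
  obtain ⟨s', hs', j', hj', m, hmd, hmc, hma, hmb, hm⟩ := exists_character_ne T hω h hne
  -- Were the characters dependent, some `m * lʳ` would be invariant, and `m` would agree as well.
  have hdet : (s * j' + 2 * (s' * j)) % 3 ≠ 0 := by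
    intro h0
    obtain ⟨r, hr, h1, h2⟩ := exists_multiple_mod_three s hs j hj hsj s' hs' j' hj' h0
    have key := h.eval_eq T h3
      ((totalDegree_mul_le hmd (totalDegree_pow_le hld r)).trans (by omega))
      (hmc.mul (hlc.pow r)) (hma.mul (hla.pow r)) (hmb.mul (hlb.pow r)) (by omega) h1 h2
    rw [map_mul, map_mul, map_pow, map_pow, hlu] at key
    exact hm (mul_right_cancel₀ (pow_ne_zero r hlw) key)
  have hm3 := h.eval_eq T h3 ((totalDegree_pow_le hmd 3).trans (by norm_num)) (hmc.pow 3)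
    (hma.pow 3) (hmb.pow 3) rfl (by omega) (by omega)
  rw [map_pow, map_pow] at hm3
  obtain ⟨t', ht', htm⟩ := exists_eq_pow_mul hω hm3
  have hmw : eval w m ≠ 0 := fun h0 => hm (by
    rw [h0] at hm3 ⊢
    exact pow_eq_zero_iff (n := 3) (by norm_num) |>.1 (by rw [hm3]; norm_num))
  -- This second element lies in the kernel of the character of `l`, so correcting `m` does not
  -- spoil `l`.
  obtain ⟨p', -, q', -, hpq0, hpq'⟩ := exists_solution_mod_three s hs j hj s' hs' j' hj' hdet t' ht'
  have hlu' := ((hla.elem_pow p').elem_mul (hlb.elem_pow q')).eval_move u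
  rw [pow_eq_pow_of_modEq h3 (show (p' * s + q' * j) % 3 = 0 % 3 by omega), pow_zero, one_mul,
    hlu] at hlu'
  have hmu := ((hma.elem_pow p').elem_mul (hmb.elem_pow q')).eval_move u
  rw [pow_eq_pow_of_modEq h3 (show (p' * s' + q' * j') % 3 = t' % 3 by omega), ← htm] at hmu
  replace h := h.move_left (a ^ p' * b ^ q')
  replace hne := fun hs => hne (SameOrbit.of_move_left (ψ := ψ) (a ^ p' * b ^ q') hs)
  obtain ⟨s'', hs'', j'', hj'', f, hfd, hfc, hfa, hfb, hf⟩ := exists_character_ne T hω h hne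
  -- The two characters now generate all others, so any third form `f` has an invariant product with
  -- powers of `l` and `m`, of degree at most 5, and no disagreement can remain.
  obtain ⟨r, hr, r', hr', h1, h2⟩ :=
    exists_combination_mod_three s hs j hj s' hs' j' hj' hdet s'' hs'' j'' hj''
  have key := h.eval_eq T h3 ((totalDegree_mul_le (totalDegree_mul_le hfd
    (totalDegree_pow_le hld r)) (totalDegree_pow_le hmd r')).trans (by omega))
    ((hfc.mul (hlc.pow r)).mul (hmc.pow r')) ((hfa.mul (hla.pow r)).mul (hma.pow r'))
    ((hfb.mul (hlb.pow r)).mul (hmb.pow r')) (by omega) h1 h2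
  simp only [map_mul, map_pow, hlu', hmu, mul_assoc] at key
  exact hf (mul_right_cancel₀ (mul_ne_zero (pow_ne_zero r hlw) (pow_ne_zero r' hmw)) key)

end Abelian

/-! ### The representation on `V₀`: sharpness and the field with four elements -/

section Heisenberg

variable {K : Type*} [Field K] {ω : K}

theorem heisTriple_of : HeisTriple (PresentedGroup.of 0 : H27) (PresentedGroup.of 1)
    (PresentedGroup.of 2) := by
  have h : ∀ r ∈ heisenbergRels, (PresentedGroup.mk heisenbergRels) r = 1 :=
    fun r hr => PresentedGroup.one_of_mem hr
  have ha := h (FreeGroup.of 0 ^ 3) (by simp [heisenbergRels])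
  have hb := h (FreeGroup.of 1 ^ 3) (by simp [heisenbergRels])
  have hc := h (FreeGroup.of 2 ^ 3) (by simp [heisenbergRels])
  have hab := h ((FreeGroup.of 0)⁻¹ * (FreeGroup.of 1)⁻¹ * FreeGroup.of 0 * FreeGroup.of 1 *
    (FreeGroup.of 2)⁻¹) (by simp [heisenbergRels])
  have hac := h (FreeGroup.of 0 * FreeGroup.of 2 * (FreeGroup.of 2 * FreeGroup.of 0)⁻¹)
    (by simp [heisenbergRels])
  have hbc := h (FreeGroup.of 1 * FreeGroup.of 2 * (FreeGroup.of 2 * FreeGroup.of 1)⁻¹)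
    (by simp [heisenbergRels])
  simp only [map_mul, map_inv, map_pow] at ha hb hc hab hac hbc
  rw [mul_inv_eq_one] at hab hac hbc
  refine ⟨ha, hb, hc, ?_, hac, hbc, ?_⟩
  · change _ = _ * PresentedGroup.mk heisenbergRels (FreeGroup.of 2)
    rw [← hab]
    simp only [mul_assoc]
    change _ = PresentedGroup.mk heisenbergRels (FreeGroup.of 1) *
      (PresentedGroup.mk heisenbergRels (FreeGroup.of 0) * _)
    rw [mul_inv_cancel_left, mul_inv_cancel_left]
    rfl
  · rw [← PresentedGroup.closure_range_of heisenbergRels]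
    congr 1
    ext g
    simp [Fin.exists_fin_succ, eq_comm]

theorem heisenbergRep_of (h : ω ^ 3 = 1) (i : Fin 3) :
    heisenbergRep ω h (PresentedGroup.of i) = genImage ω h i :=
  PresentedGroup.toGroup.of _

theorem coe_heisenbergRep_inv (h : ω ^ 3 = 1) {i : Fin 3} (hi : (PresentedGroup.of i : H27) ^ 3 = 1) :
    (heisenbergRep ω h (PresentedGroup.of i)⁻¹ : Matrix (Fin 3) (Fin 3) K) =
      (genImage ω h i : Matrix (Fin 3) (Fin 3) K) ^ 2 := by
  have : (PresentedGroup.of i : H27)⁻¹ = PresentedGroup.of i ^ 2 := by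
    rw [inv_eq_iff_mul_eq_one, ← pow_succ', hi]
  rw [this, map_pow, heisenbergRep_of, Units.val_pow_eq_pow_val]

/-- Polynomials are moved by the inverse matrices, so the root of unity here is `ω² = ω⁻¹`. -/
theorem coords_heisenbergRep (h : ω ^ 3 = 1) : Coords (ω ^ 2) (heisenbergRep ω h)
    (PresentedGroup.of 0) (PresentedGroup.of 1) (PresentedGroup.of 2) (X 0) (X 1) (X 2) := by
  have T := heisTriple_of
  have hA := coe_heisenbergRep_inv h T.a3
  have hB := coe_heisenbergRep_inv h T.b3
  have hC := coe_heisenbergRep_inv h T.c3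
  have eA : (genImage ω h 0 : Matrix (Fin 3) (Fin 3) K) = matA ω := rfl
  have eB : (genImage ω h 1 : Matrix (Fin 3) (Fin 3) K) = matB K := rfl
  have eC : (genImage ω h 2 : Matrix (Fin 3) (Fin 3) K) = matC ω := rfl
  rw [eA] at hA
  rw [eB] at hB
  rw [eC] at hC
  constructor
  case dx | dy | dz => exact (totalDegree_X _).le
  all_goals
    simp only [Wt, polyAct, aeval_X, hA, hB, hC]
    simp [pow_two, matA, matB, matC, Matrix.mul_apply, Fin.sum_univ_three]

variable {v w : Fin 3 → K} {f : MvPolynomial (Fin 3) K}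

theorem exists_move_heisenbergRep (hω : IsPrimitiveRoot ω 3)
    (hc : (w 0 ^ 3 = v 0 ^ 3 ∧ w 1 ^ 3 = v 1 ^ 3 ∧ w 2 ^ 3 = v 2 ^ 3) ∨
      (w 0 ^ 3 = v 1 ^ 3 ∧ w 1 ^ 3 = v 2 ^ 3 ∧ w 2 ^ 3 = v 0 ^ 3) ∨
      (w 0 ^ 3 = v 2 ^ 3 ∧ w 1 ^ 3 = v 0 ^ 3 ∧ w 2 ^ 3 = v 1 ^ 3))
    (hm : w 0 * w 1 * w 2 = v 0 * v 1 * v 2) :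
    SameOrbit (heisenbergRep ω hω.pow_eq_one) v w := by
  obtain ⟨g, h0, h1, h2⟩ := exists_move_of_cubes (v := v) (w := w)
    (hω.pow_of_coprime 2 (by norm_num)) (coords_heisenbergRep hω.pow_eq_one)
    (by simpa only [eval_X] using hc) (by simpa only [eval_X] using hm)
  simp only [eval_X] at h0 h1 h2
  refine SameOrbit.of_move_left g (SameOrbit.of_eq ?_)
  ext i
  fin_cases i
  exacts [h0.symm, h1.symm, h2.symm]

theorem eval_eq_of_sameOrbit {G : Type*} [Group G] {n : ℕ} {ψ : G →* GL (Fin n) K}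
    {v w : Fin n → K} {f : MvPolynomial (Fin n) K} (hf : f ∈ invariants ψ)
    (h : SameOrbit ψ v w) : eval w f = eval v f := by
  obtain ⟨g, rfl⟩ := h
  exact eval_mulVec_of_mem_invariants hf g v

/-- The sum of the values of the monomial with exponents `i, j, k` over the orbit of `(p, q, 0)`. -/
def orbitSum (ω p q : K) (i j k : ℕ) : K :=
  ∑ s ∈ Finset.range 3, ∑ t ∈ Finset.range 3,
    ((ω ^ s * p) ^ i * (ω ^ t * q) ^ j * 0 ^ k + 0 ^ i * (ω ^ s * p) ^ j * (ω ^ t * q) ^ k +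
      (ω ^ t * q) ^ i * 0 ^ j * (ω ^ s * p) ^ k)

/-- As one coordinate is zero, the condition on the product `xyz` is void: the two other coordinates
can be scaled by independent cube roots of unity, and shifted cyclically, within the orbit. Summing
the constant value of `f` over these 27 choices gives the formula. -/
theorem eval_eq_sum_orbitSum (hω : IsPrimitiveRoot ω 3)
    (hf : f ∈ invariants (heisenbergRep ω hω.pow_eq_one)) (p q : K) :
    27 * eval ![p, q, 0] f = ∑ d ∈ f.support, coeff d f * orbitSum ω p q (d 0) (d 1) (d 2) := by
  have h3 := hω.pow_eq_one
  have hc : ∀ (s : ℕ) (t : K), (ω ^ s * t) ^ 3 = t ^ 3 := fun s t => by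
    rw [mul_pow, ← pow_mul, mul_comm s, pow_mul, h3, one_pow, one_mul]
  have h1 : ∀ s t : ℕ, eval ![ω ^ s * p, ω ^ t * q, 0] f = eval ![p, q, 0] f := fun s t =>
    eval_eq_of_sameOrbit hf (exists_move_heisenbergRep hω (by simp [hc]) (by simp))
  have h2 : ∀ s t : ℕ, eval ![0, ω ^ s * p, ω ^ t * q] f = eval ![p, q, 0] f := fun s t =>
    eval_eq_of_sameOrbit hf (exists_move_heisenbergRep hω (by simp [hc]) (by simp))
  have h4 : ∀ s t : ℕ, eval ![ω ^ t * q, 0, ω ^ s * p] f = eval ![p, q, 0] f := fun s t =>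
    eval_eq_of_sameOrbit hf (exists_move_heisenbergRep hω (by simp [hc]) (by simp))
  have key : 27 * eval ![p, q, 0] f = ∑ s ∈ Finset.range 3, ∑ t ∈ Finset.range 3,
      (eval ![ω ^ s * p, ω ^ t * q, 0] f + eval ![0, ω ^ s * p, ω ^ t * q] f +
        eval ![ω ^ t * q, 0, ω ^ s * p] f) := by
    simp only [h1, h2, h4, Finset.sum_const, Finset.card_range, nsmul_eq_mul]
    push_cast
    ring
  rw [key]
  simp only [eval_eq', Fin.prod_univ_three, orbitSum, ← Finset.sum_add_distrib, Finset.mul_sum]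
  symm
  rw [Finset.sum_comm]
  refine Finset.sum_congr rfl fun s _ => ?_
  rw [Finset.sum_comm]
  refine Finset.sum_congr rfl fun t _ => Finset.sum_congr rfl fun d _ => ?_
  simp only [Matrix.cons_val]
  ring

theorem sum_pow_eq_zero (hω : IsPrimitiveRoot ω 3) {i : ℕ} (hi : i % 3 ≠ 0) :
    ∑ s ∈ Finset.range 3, (ω ^ s) ^ i = 0 := by
  have h0 := one_add_add_sq hω
  have h3 := hω.pow_eq_one
  simp only [Finset.sum_range_succ, Finset.sum_range_zero, ← pow_mul]
  obtain h | h : i % 3 = 1 ∨ i % 3 = 2 := by omega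
  · rw [pow_eq_pow_of_modEq h3 (show (0 * i) % 3 = 0 % 3 by omega),
      pow_eq_pow_of_modEq h3 (show (1 * i) % 3 = 1 % 3 by omega),
      pow_eq_pow_of_modEq h3 (show (2 * i) % 3 = 2 % 3 by omega)]
    linear_combination h0
  · rw [pow_eq_pow_of_modEq h3 (show (0 * i) % 3 = 0 % 3 by omega),
      pow_eq_pow_of_modEq h3 (show (1 * i) % 3 = 2 % 3 by omega),
      pow_eq_pow_of_modEq h3 (show (2 * i) % 3 = 1 % 3 by omega)]
    linear_combination h0

theorem sum_pow_eq_three (hω : ω ^ 3 = 1) {i : ℕ} (hi : i % 3 = 0) :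
    ∑ s ∈ Finset.range 3, (ω ^ s) ^ i = 3 := by
  simp only [← pow_mul]
  rw [Finset.sum_congr rfl fun s _ => pow_eq_pow_of_modEq hω
    (show (s * i) % 3 = 0 % 3 by simp [Nat.mul_mod, hi])]
  simp

theorem orbitSum_eq (p q : K) (i j k : ℕ) :
    orbitSum ω p q i j k =
      (∑ s ∈ Finset.range 3, (ω ^ s) ^ i) * (∑ s ∈ Finset.range 3, (ω ^ s) ^ j) *
          (p ^ i * q ^ j * 0 ^ k) +
        (∑ s ∈ Finset.range 3, (ω ^ s) ^ j) * (∑ s ∈ Finset.range 3, (ω ^ s) ^ k) *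
          (p ^ j * q ^ k * 0 ^ i) +
        (∑ s ∈ Finset.range 3, (ω ^ s) ^ k) * (∑ s ∈ Finset.range 3, (ω ^ s) ^ i) *
          (p ^ k * q ^ i * 0 ^ j) := by
  simp only [orbitSum, Finset.sum_range_succ, Finset.sum_range_zero]
  ring

theorem orbitSum_of_mod_eq_zero (hω : ω ^ 3 = 1) (p q : K) {i j k : ℕ} (hi : i % 3 = 0)
    (hj : j % 3 = 0) (hk : k % 3 = 0) : orbitSum ω p q i j k =
      9 * (p ^ i * q ^ j * 0 ^ k + p ^ j * q ^ k * 0 ^ i + p ^ k * q ^ i * 0 ^ j) := by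
  rw [orbitSum_eq, sum_pow_eq_three hω hi, sum_pow_eq_three hω hj, sum_pow_eq_three hω hk]
  ring

/-- Each of the three summands contains either a vanishing sum of roots of unity or a positive power
of 0. -/
theorem orbitSum_eq_zero (hω : IsPrimitiveRoot ω 3) (p q : K) {i j k : ℕ}
    (h : ¬ (i % 3 = 0 ∧ j % 3 = 0 ∧ k % 3 = 0)) : orbitSum ω p q i j k = 0 := by
  rw [orbitSum_eq]
  by_cases hi : i % 3 = 0
  · by_cases hj : j % 3 = 0
    · have hk : k % 3 ≠ 0 := fun hk => h ⟨hi, hj, hk⟩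
      rw [sum_pow_eq_zero hω hk, zero_pow (by omega : k ≠ 0)]
      ring
    · rw [sum_pow_eq_zero hω hj, zero_pow (by omega : j ≠ 0)]
      ring
  · rw [sum_pow_eq_zero hω hi, zero_pow (by omega : i ≠ 0)]
    ring

theorem twentySeven_ne_zero (hω : IsPrimitiveRoot ω 3) : (27 : K) ≠ 0 := by
  have h := pow_ne_zero 3 (three_ne_zero_of_primitive hω)
  norm_num at h
  exact h

theorem agree_of_orbitSum_eq (hω : IsPrimitiveRoot ω 3) {d : ℕ} {p q p' q' : K}
    (h : ∀ i j k, i % 3 = 0 → j % 3 = 0 → k % 3 = 0 → i + j + k ≤ d →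
      orbitSum ω p q i j k = orbitSum ω p' q' i j k) :
    Agree (heisenbergRep ω hω.pow_eq_one) d ![p, q, 0] ![p', q', 0] := by
  intro f hf hd
  refine mul_left_cancel₀ (twentySeven_ne_zero hω) ?_
  rw [eval_eq_sum_orbitSum hω hf, eval_eq_sum_orbitSum hω hf]
  refine Finset.sum_congr rfl fun m hm => ?_
  congr 1
  by_cases hmod : m 0 % 3 = 0 ∧ m 1 % 3 = 0 ∧ m 2 % 3 = 0
  · refine h _ _ _ hmod.1 hmod.2.1 hmod.2.2 ?_
    have := (le_totalDegree hm).trans hd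
    rwa [Finsupp.sum_fintype _ _ (fun _ => rfl), Fin.sum_univ_three] at this
  · rw [orbitSum_eq_zero hω _ _ hmod, orbitSum_eq_zero hω _ _ hmod]

/-- Exponents divisible by 3 with sum at most 8 have sum at most 6, and the surviving sums are
multiples of 1, `p³ + q³`, `p⁶ + q⁶`, `p³q³`, all symmetric in `p, q`. -/
theorem agree_eight (hω : IsPrimitiveRoot ω 3) (y : K) :
    Agree (heisenbergRep ω hω.pow_eq_one) 8 ![1, y, 0] ![y, 1, 0] := by
  refine agree_of_orbitSum_eq hω fun i j k hi hj hk hd => ?_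
  rw [orbitSum_of_mod_eq_zero hω.pow_eq_one _ _ hi hj hk,
    orbitSum_of_mod_eq_zero hω.pow_eq_one _ _ hi hj hk]
  obtain rfl | rfl | rfl : i = 0 ∨ i = 3 ∨ i = 6 := by omega
  all_goals obtain rfl | rfl | rfl : j = 0 ∨ j = 3 ∨ j = 6 := by omega
  all_goals obtain rfl | rfl | rfl : k = 0 ∨ k = 3 ∨ k = 6 := by omega
  all_goals first
    | omega
    | ring1

theorem not_sameOrbit_swap (hω : IsPrimitiveRoot ω 3) {y : K} (hy : y ≠ 0) (hy3 : y ^ 3 ≠ 1) :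
    ¬ SameOrbit (heisenbergRep ω hω.pow_eq_one) ![1, y, 0] ![y, 1, 0] := by
  intro h
  have hω2 : (ω ^ 2) ^ 3 = 1 := (hω.pow_of_coprime 2 (by norm_num)).pow_eq_one
  have := eval_eq_of_sameOrbit ((coords_heisenbergRep hω.pow_eq_one).cyclic_mem heisTriple_of hω2) h
  simp at this
  refine hy3 (mul_left_cancel₀ (pow_ne_zero 3 hy) ?_)
  linear_combination this

/-- Otherwise `K = {0, 1, ω, ω²}`. Infinite fields are covered, since `Nat.card` is then 0. -/
theorem exists_cube_ne_one (hω : IsPrimitiveRoot ω 3) (hK : Nat.card K ≠ 4) :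
    ∃ y : K, y ≠ 0 ∧ y ^ 3 ≠ 1 := by
  classical
  by_contra! h
  have hne := hω.ne_one (by norm_num)
  have h0 := hω.ne_zero (by norm_num)
  have huniv : (Set.univ : Set K) = (({0, 1, ω, ω ^ 2} : Finset K) : Set K) := by
    ext y
    simp only [Set.mem_univ, Finset.coe_insert, Finset.coe_singleton, Set.mem_insert_iff,
      Set.mem_singleton_iff, true_iff]
    by_cases hy : y = 0
    · exact .inl hy
    obtain ⟨i, hi, rfl⟩ := hω.eq_pow_of_pow_eq_one (h y hy)
    interval_cases i <;> simp
  refine hK ?_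
  rw [← Set.ncard_univ, huniv, Set.ncard_coe_finset]
  have h12 : (1 : K) ≠ ω ^ 2 := fun h => hne (by
    have := hω.pow_eq_one
    rw [pow_succ, ← h, one_mul] at this
    exact this)
  have h22 : ω ≠ ω ^ 2 := fun h => hne (mul_left_cancel₀ h0 (by rw [← pow_two, ← h, mul_one]))
  rw [Finset.card_insert_of_notMem, Finset.card_insert_of_notMem, Finset.card_insert_of_notMem,
    Finset.card_singleton]
  · simpa using h22
  · simpa using ⟨hne.symm, h12⟩
  · simp [Ne.symm h0, (pow_ne_zero 2 h0).symm]

theorem betaSep_eq_nine (hω : IsPrimitiveRoot ω 3) (hK : Nat.card K ≠ 4) :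
    betaSep K H27 = 9 := by
  refine le_antisymm (iSup₂_le fun n ψ => ?_) ?_
  · exact betaSepRep_le (d := 9) (by norm_num) fun v w h => sameOrbit_of_agree heisTriple_of hω h
  · obtain ⟨y, hy, hy3⟩ := exists_cube_ne_one hω hK
    exact (le_betaSepRep (agree_eight hω y) (not_sameOrbit_swap hω hy hy3)).trans
      (le_iSup₂ (f := fun (n : ℕ) (ψ : H27 →* GL (Fin n) K) => betaSepRep ψ) 3
        (heisenbergRep ω hω.pow_eq_one))

theorem two_eq_zero_of_card (hK : Nat.card K = 4) : (2 : K) = 0 := by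
  have : Finite K := Nat.finite_of_card_ne_zero (by omega)
  have := Fintype.ofFinite K
  have h := FiniteField.cast_card_eq_zero K
  rw [← Nat.card_eq_fintype_card, hK] at h
  have h4 : (2 : K) * 2 = 0 := by
    push_cast at h
    linear_combination h
  simpa using h4

theorem cube_eq_zero_or_one (hK : Nat.card K = 4) (t : K) : t ^ 3 = 0 ∨ t ^ 3 = 1 := by
  have : Finite K := Nat.finite_of_card_ne_zero (by omega)
  have := Fintype.ofFinite K
  by_cases ht : t = 0
  · simp [ht]
  · right
    have h := FiniteField.pow_card_sub_one_eq_one t ht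
    rwa [← Nat.card_eq_fintype_card, hK] at h

theorem sameOrbit_of_agree_six (hω : IsPrimitiveRoot ω 3) (hK : Nat.card K = 4)
    (h : Agree (heisenbergRep ω hω.pow_eq_one) 6 v w) :
    SameOrbit (heisenbergRep ω hω.pow_eq_one) v w := by
  have hω2 : (ω ^ 2) ^ 3 = 1 := (hω.pow_of_coprime 2 (by norm_num)).pow_eq_one
  have S := coords_heisenbergRep hω.pow_eq_one
  have hm := S.agree_mul heisTriple_of hω2 (by norm_num) h
  have h1 := S.agree_e1 heisTriple_of hω2 (by norm_num) h
  have h2 := S.agree_e2 heisTriple_of hω2 le_rfl h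
  simp only [eval_X] at hm h1 h2
  refine exists_move_heisenbergRep hω ?_ hm
  have h20 := two_eq_zero_of_card hK
  have h11 : (1 : K) + 1 = 0 := by linear_combination h20
  -- In characteristic 2 the first two elementary symmetric functions determine how many of three
  -- cubes are 1 (values `(0,0), (1,0), (0,1), (1,1)` for 0 to 3 ones), and a 0-1 triple is
  -- determined up to cyclic shift by that number.
  rcases cube_eq_zero_or_one hK (v 0) with e0 | e0 <;>
  rcases cube_eq_zero_or_one hK (v 1) with e1 | e1 <;>
  rcases cube_eq_zero_or_one hK (v 2) with e2 | e2 <;>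
  rcases cube_eq_zero_or_one hK (w 0) with d0 | d0 <;>
  rcases cube_eq_zero_or_one hK (w 1) with d1 | d1 <;>
  rcases cube_eq_zero_or_one hK (w 2) with d2 | d2 <;>
  simp_all

/-- Below degree 6 the only nonconstant survivor is `p³ + q³`, which is `1 + 1 = 0` at `(1, 1, 0)`.
-/
theorem agree_five (hω : IsPrimitiveRoot ω 3) (hK : Nat.card K = 4) :
    Agree (heisenbergRep ω hω.pow_eq_one) 5 ![0, 0, 0] ![1, 1, 0] := by
  have h2 := two_eq_zero_of_card hK
  refine agree_of_orbitSum_eq hω fun i j k hi hj hk hd => ?_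
  rw [orbitSum_of_mod_eq_zero hω.pow_eq_one _ _ hi hj hk,
    orbitSum_of_mod_eq_zero hω.pow_eq_one _ _ hi hj hk]
  obtain rfl | rfl : i = 0 ∨ i = 3 := by omega
  all_goals obtain rfl | rfl : j = 0 ∨ j = 3 := by omega
  all_goals obtain rfl | rfl : k = 0 ∨ k = 3 := by omega
  all_goals first
    | omega
    | ring1
    | linear_combination (-9) * h2

theorem not_sameOrbit_zero (hω : IsPrimitiveRoot ω 3) :
    ¬ SameOrbit (heisenbergRep ω hω.pow_eq_one) ![0, 0, 0] ![1, 1, 0] := by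
  intro h
  have hω2 : (ω ^ 2) ^ 3 = 1 := (hω.pow_of_coprime 2 (by norm_num)).pow_eq_one
  have := eval_eq_of_sameOrbit ((coords_heisenbergRep hω.pow_eq_one).e2_mem heisTriple_of hω2) h
  simp at this

theorem betaSepRep_heisenbergRep (hω : IsPrimitiveRoot ω 3) (hK : Nat.card K = 4) :
    betaSepRep (heisenbergRep ω hω.pow_eq_one) = 6 :=
  le_antisymm (betaSepRep_le (d := 6) (by norm_num) fun _ _ h => sameOrbit_of_agree_six hω hK h)
    (le_betaSepRep (agree_five hω hK) (not_sameOrbit_zero hω))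

end Heisenberg

end SepInv

theorem mainTheorem10 {K : Type*} [Field K] (ω : K) (hω : IsPrimitiveRoot ω 3) :
    (Nat.card K ≠ 4 →
      SepInv.betaSep K SepInv.H27 = 9 ∧
      ∃ v w : Fin 3 → K,
        SepInv.orbit (SepInv.heisenbergRep ω hω.pow_eq_one) v ≠
          SepInv.orbit (SepInv.heisenbergRep ω hω.pow_eq_one) w ∧
        ∀ f ∈ SepInv.invariants (SepInv.heisenbergRep ω hω.pow_eq_one),
          f.totalDegree < 9 → MvPolynomial.eval v f = MvPolynomial.eval w f) ∧
    (Nat.card K = 4 →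
      SepInv.betaSepRep (SepInv.heisenbergRep ω hω.pow_eq_one) = 6) := by
  refine ⟨fun hK => ⟨SepInv.betaSep_eq_nine hω hK, ?_⟩, SepInv.betaSepRep_heisenbergRep hω⟩
  obtain ⟨y, hy, hy3⟩ := SepInv.exists_cube_ne_one hω hK
  exact ⟨![1, y, 0], ![y, 1, 0], mt SepInv.orbit_eq_iff.1 (SepInv.not_sameOrbit_swap hω hy hy3),
    fun f hf hd => SepInv.agree_eight hω y f hf (Nat.le_of_lt_succ hd)⟩
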